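/- Let $\mathbb F$ be a field of characteristic $0$ and let $\mathcal V$ be a differential algebra: a unital commutative associative $\mathbb F$-algebra with an $\mathbb F$-linear derivation $\partial$. Let $\mathcal V((\partial^{-1}))$ be the algebra of pseudodifferential operators $A(\partial)=\sum_{n\le K}a_n\partial^n$ over $\mathcal V$; the symbol of $A(\partial)$ is $A(z)=\sum_{n\le K} a_nz^n$, the product is $(A\circ B)(z)=A(z+\partial)B(z)$, with powers of $z+\partial$ expanded in nonnegative powers of $\partial$, and the formal adjoint is $A^*(\partial)=\sum_n(-\partial)^n\circ a_n$. Let $\{\cdot\,_\lambda\,\cdot\}$ be a $\lambda$-bracket on $\mathcal V$, i.e. an $\mathbb F$-bilinear map $\mathcal V\times\mathcal V\to\mathcal V[\lambda]$ such that, for all $a,b,c\in\mathcal V$, $$\{\partial a_\lambda b\}=-\lambda\{a_\lambda b\},\qquad \{a_\lambda\partial b\}=(\lambda+\partial)\{a_\lambda b\},\qquad \{a_\lambda bc\}=\{a_\lambda b\}c+\{a_\lambda c\}b,$$ $$\{ab_\lambda c\}=\{a_{\lambda+x}c\}\big(\big|_{x=\partial}b\big)+\{b_{\lambda+x}c\}\big(\big|_{x=\partial}a\big),$$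 where $P(\lambda+x)\big(\big|_{x=\partial}b\big)=\sum_n p_n(\lambda+\partial)^nb$ for $P(\lambda)=\sum_n p_n\lambda^n\in\mathcal V[\lambda]$. (Skewsymmetry and the Jacobi identity are not assumed.) A matrix pseudodifferential operator $A(\partial)\in\mathrm{Mat}_{P\times R}\,\mathcal V((\partial^{-1}))$ is of Adler type with respect to $\{\cdot\,_\lambda\,\cdot\}$ if, for all $i,h\in\{1,\dots,P\}$ and $j,k\in\{1,\dots,R\}$, $$\{A_{ij}(z)_\lambda A_{hk}(w)\}=A_{hj}(w+\lambda+\partial)\,\iota_z(z-w-\lambda-\partial)^{-1}(A_{ik})^*(\lambda-z)-A_{hj}(z)\,\iota_z(z-w-\lambda-\partial)^{-1}A_{ik}(w),$$ as an identity of formal series in $z,w$ with coefficients in $\mathcal V[\lambda]$. Here $\iota_z(z-w-\lambda-\partial)^{-1}=\sum_{p\ge0}z^{-p-1}(w+\lambda+\partial)^p$, powers of $w+\lambda+\partial$ and of $\lambda-z$ are expanded in nonnegative powers of $\lambda+\partial$ and of $\lambda$ respectively, and $\partial$ acts on the coefficients of the series to its right. **Proposition.** Let $M\le N$, let $A(\partial)\in\mathrm{Mat}_{N\times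 N}\,\mathcal V((\partial^{-1}))$ be of Adler type with respect to $\{\cdot\,_\lambda\,\cdot\}$, and let $I\in\mathrm{Mat}_{N\times M}\,\mathbb F$ and $J\in\mathrm{Mat}_{M\times N}\,\mathbb F$ be constant matrices. Suppose that the generalized quasideterminant $$|A(\partial)|_{IJ}=(J\,A(\partial)^{-1}I)^{-1}$$ exists, i.e. that $A(\partial)$ is invertible in $\mathrm{Mat}_{N\times N}\,\mathcal V((\partial^{-1}))$ and $J A(\partial)^{-1}I$ is invertible in $\mathrm{Mat}_{M\times M}\,\mathcal V((\partial^{-1}))$. Then $|A(\partial)|_{IJ}$ is a matrix pseudodifferential operator of Adler type with respect to the same $\lambda$-bracket $\{\cdot\,_\lambda\,\cdot\}$. -/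

import Mathlib

open Polynomial

noncomputable section

namespace AdlerType

variable {F V : Type*} [Field F] [CommRing V] [Algebra F V]

/-! ### Pseudodifferential operators over the differential algebra `(V, d)` -/

/-- The two-sided sequences of elements of `V` that vanish in all large enough degrees, i.e. the
formal Laurent series `∑_{n ≤ N} a_n z^n` in `z⁻¹`. -/
def boundedAbove (V : Type*) [CommRing V] : AddSubgroup (ℤ → V) where
  carrier := {a | ∃ N : ℤ, ∀ n, N < n → a n = 0}
  zero_mem' := ⟨0, fun _ _ => rfl⟩
  add_mem' := by
    rintro a b ⟨N, hN⟩ ⟨K, hK⟩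
    refine ⟨max N K, fun n hn => ?_⟩
    simp [hN n (lt_of_le_of_lt (le_max_left _ _) hn), hK n (lt_of_le_of_lt (le_max_right _ _) hn)]
  neg_mem' := by
    rintro a ⟨N, hN⟩
    exact ⟨N, fun n hn => by simp [hN n hn]⟩

/-- Scalar pseudodifferential operators `∑_{n ≤ N} a_n ∂^n` over the differential algebra `V`
with derivation `d`, recorded by their coefficients.  The derivation is a parameter of the type
because the product depends on it. -/
def PseudoDiffOp (_d : Derivation F V V) : Type _ := boundedAbove V

namespace PseudoDiffOp

variable {d : Derivation F V V}

instance : AddCommGroup (PseudoDiffOp d) := inferInstanceAs (AddCommGroup (boundedAbove V))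

/-- The coefficient `a_n` of `∂^n` in `A(∂) = ∑ a_n ∂^n` (equally, of `z^n` in the symbol). -/
def coeff (A : PseudoDiffOp d) (n : ℤ) : V := A.1 n

theorem coeff_bounded (A : PseudoDiffOp d) : ∃ N : ℤ, ∀ n, N < n → A.coeff n = 0 := A.2

/-- The operator of multiplication by a constant of the base field. -/
def const (d : Derivation F V V) (c : F) : PseudoDiffOp d :=
  ⟨fun n => if n = 0 then algebraMap F V c else 0, 0, fun _ hn => if_neg hn.ne'⟩

instance : One (PseudoDiffOp d) := ⟨const d 1⟩

/-- The product `(A ∘ B)(z) = A(z + ∂) B(z)`, with `(z + ∂)^m` expanded in nonnegative powers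
of `∂`:  `(A ∘ B)_n = ∑_{m ∈ ℤ, k ≥ 0} binom(m, k) a_m ∂^k(b_{n - m + k})`, a finite sum. -/
instance : Mul (PseudoDiffOp d) where
  mul A B :=
    ⟨fun n => ∑ᶠ x : ℤ × ℕ, Ring.choose x.1 x.2 •
        (A.coeff x.1 * ((d : V →ₗ[F] V) ^ x.2) (B.coeff (n - x.1 + x.2))), by
      obtain ⟨N, hN⟩ := A.coeff_bounded
      obtain ⟨K, hK⟩ := B.coeff_bounded
      refine ⟨N + K, fun n hn => finsum_eq_zero_of_forall_eq_zero fun x => ?_⟩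
      by_cases h : N < x.1
      · simp [hN _ h]
      · rw [hK (n - x.1 + x.2) (by omega)]
        simp⟩

/-- The formal adjoint `A^*(∂) = ∑_n (-∂)^n ∘ a_n`; since
`(-∂)^m ∘ a = (-1)^m ∑_{k ≥ 0} binom(m, k) ∂^k(a) ∂^{m - k}`, its coefficient of `∂^n` is the
finite sum `∑_{k ≥ 0} (-1)^{n + k} binom(n + k, k) ∂^k(a_{n + k})`. -/
def adjoint (A : PseudoDiffOp d) : PseudoDiffOp d :=
  ⟨fun n => ∑ᶠ k : ℕ, (((n + k).negOnePow : ℤ) * Ring.choose (n + k) k) •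
      ((d : V →ₗ[F] V) ^ k) (A.coeff (n + k)), by
    obtain ⟨N, hN⟩ := A.coeff_bounded
    refine ⟨N, fun n hn => finsum_eq_zero_of_forall_eq_zero fun k => ?_⟩
    rw [hN (n + k) (by omega)]
    simp⟩

end PseudoDiffOp

/-! ### `λ`-brackets.  The variable `λ` is `X` in `V[X]`. -/

/-- The operator `λ + ∂` on `V[λ]`, where `∂` acts on coefficients. -/
def lamAdd (d : Derivation F V V) : V[X] →ₗ[F] V[X] :=
  LinearMap.mulLeft F X +
    lsum fun n => (monomial n : V →ₗ[V] V[X]).restrictScalars F ∘ₗ (d : V →ₗ[F] V)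

/-- `P(λ + x) (|_{x = ∂} b) = ∑_n p_n (λ + ∂)^n b` for `P(λ) = ∑_n p_n λ^n`. -/
def substApply (d : Derivation F V V) (P : V[X]) (b : V) : V[X] :=
  P.sum fun n p => C p * (lamAdd d ^ n) (C b)

/-- A `λ`-bracket on the differential algebra `(V, d)`: a bilinear map `V × V → V[λ]` with
sesquilinearity and the two Leibniz rules (neither skewsymmetry nor the Jacobi identity). -/
structure LambdaBracket (d : Derivation F V V) where
  /-- `br a b = {a_λ b}` -/
  br : V →ₗ[F] V →ₗ[F] V[X]
  deriv_left : ∀ a b, br (d a) b = -(X * br a b)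
  deriv_right : ∀ a b, br a (d b) = lamAdd d (br a b)
  leibniz_right : ∀ a b c, br a (b * c) = br a b * C c + br a c * C b
  leibniz_left : ∀ a b c, br (a * b) c = substApply d (br a c) b + substApply d (br b c) a

/-! ### The Adler identity

Both sides are formal series in `z, w` (of both signs of degree) with coefficients in `V[λ]`, and
are given by their coefficients of `z^r w^s`. -/

namespace PseudoDiffOp

variable {d : Derivation F V V}

/-- The coefficient of `z^r` in `A(λ - z)`, expanded in nonnegative powers of `λ`:
`a_m (λ - z)^m = a_m ∑_{l ≥ 0} (-1)^{m - l} binom(m, l) λ^l z^{m - l}`. -/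
def evalLamSub (A : PseudoDiffOp d) (r : ℤ) : V[X] :=
  ∑ᶠ l : ℕ, ((r.negOnePow : ℤ) * Ring.choose (r + l) l) • monomial l (A.coeff (r + l))

/-- The coefficient of `z^r w^s` in
`B(w + λ + ∂) ι_z(z - w - λ - ∂)⁻¹ A^*(λ - z)`, where
`ι_z(z - w - λ - ∂)⁻¹ = ∑_{p ≥ 0} z^{-p-1} (w + λ + ∂)^p` and the powers
`(w + λ + ∂)^{m + p} = ∑_{q ≥ 0} binom(m + p, q) w^{m + p - q} (λ + ∂)^q`, `m ∈ ℤ`, which arise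
from `B(w + λ + ∂) = ∑_m b_m (w + λ + ∂)^m`, act on the coefficients of `A^*(λ - z)`.
(Here `m = s + q - p`.) -/
def adlerFst (B A : PseudoDiffOp d) (r s : ℤ) : V[X] :=
  ∑ᶠ x : ℕ × ℕ, Ring.choose (s + x.2) x.2 •
    (C (B.coeff (s + x.2 - x.1)) * (lamAdd d ^ x.2) (A.adjoint.evalLamSub (r + x.1 + 1)))

/-- The coefficient of `z^r w^s` in `B(z) ι_z(z - w - λ - ∂)⁻¹ A(w)`, where
`ι_z(z - w - λ - ∂)⁻¹ = ∑_{p ≥ 0} z^{-p-1} ∑_q binom(p, q) w^{p - q} (λ + ∂)^q` acts on the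
coefficients of `A(w)`. -/
def adlerSnd (B A : PseudoDiffOp d) (r s : ℤ) : V[X] :=
  ∑ᶠ x : ℕ × ℕ, x.1.choose x.2 •
    (C (B.coeff (r + x.1 + 1)) * (lamAdd d ^ x.2) (C (A.coeff (s + x.2 - x.1))))

/-! All the sums above are finite. -/

theorem finite_support_mul (A B : PseudoDiffOp d) (n : ℤ) :
    (Function.support fun x : ℤ × ℕ => Ring.choose x.1 x.2 •
      (A.coeff x.1 * ((d : V →ₗ[F] V) ^ x.2) (B.coeff (n - x.1 + x.2)))).Finite := by
  obtain ⟨N, hN⟩ := A.coeff_bounded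
  obtain ⟨K, hK⟩ := B.coeff_bounded
  refine ((Set.finite_Icc (n - K) N).prod (Set.finite_Iic (K - n + N).toNat)).subset ?_
  rintro ⟨m, k⟩ hx
  have h1 : m ≤ N := by
    by_contra h
    exact hx (by simp [hN m (by omega)])
  have h2 : n - m + k ≤ K := by
    by_contra h
    exact hx (by simp [hK (n - m + k) (by omega)])
  simp only [Set.mem_prod, Set.mem_Icc, Set.mem_Iic]
  omega

theorem finite_support_adjoint (A : PseudoDiffOp d) (n : ℤ) :
    (Function.support fun k : ℕ => (((n + k).negOnePow : ℤ) * Ring.choose (n + k) k) •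
      ((d : V →ₗ[F] V) ^ k) (A.coeff (n + k))).Finite := by
  obtain ⟨N, hN⟩ := A.coeff_bounded
  refine (Set.finite_Iic (N - n).toNat).subset fun k hx => ?_
  have h1 : n + k ≤ N := by
    by_contra h
    exact hx (by simp [hN (n + k) (by omega)])
  simp only [Set.mem_Iic]
  omega

theorem finite_support_evalLamSub (A : PseudoDiffOp d) (r : ℤ) :
    (Function.support fun l : ℕ => ((r.negOnePow : ℤ) * Ring.choose (r + l) l) •
      monomial l (A.coeff (r + l))).Finite := by
  obtain ⟨N, hN⟩ := A.coeff_bounded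
  refine (Set.finite_Iic (N - r).toNat).subset fun k hx => ?_
  have h1 : r + k ≤ N := by
    by_contra h
    exact hx (by simp [hN (r + k) (by omega)])
  simp only [Set.mem_Iic]
  omega

theorem evalLamSub_bounded (A : PseudoDiffOp d) : ∃ N : ℤ, ∀ r, N < r → A.evalLamSub r = 0 := by
  obtain ⟨N, hN⟩ := A.coeff_bounded
  refine ⟨N, fun r hr => finsum_eq_zero_of_forall_eq_zero fun l => ?_⟩
  rw [hN (r + l) (by omega)]
  simp

theorem finite_support_adlerFst (B A : PseudoDiffOp d) (r s : ℤ) :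
    (Function.support fun x : ℕ × ℕ => Ring.choose (s + x.2) x.2 •
      (C (B.coeff (s + x.2 - x.1)) *
        (lamAdd d ^ x.2) (A.adjoint.evalLamSub (r + x.1 + 1)))).Finite := by
  obtain ⟨N, hN⟩ := A.adjoint.evalLamSub_bounded
  obtain ⟨K, hK⟩ := B.coeff_bounded
  refine ((Set.finite_Iic (N - r - 1).toNat).prod
    (Set.finite_Iic (K - s + (N - r - 1).toNat).toNat)).subset ?_
  rintro ⟨p, q⟩ hx
  have h1 : r + p + 1 ≤ N := by
    by_contra h
    exact hx (by simp [hN (r + p + 1) (by omega)])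
  have h2 : s + q - p ≤ K := by
    by_contra h
    exact hx (by simp [hK (s + q - p) (by omega)])
  simp only [Set.mem_prod, Set.mem_Iic]
  omega

theorem finite_support_adlerSnd (B A : PseudoDiffOp d) (r s : ℤ) :
    (Function.support fun x : ℕ × ℕ => x.1.choose x.2 •
      (C (B.coeff (r + x.1 + 1)) *
        (lamAdd d ^ x.2) (C (A.coeff (s + x.2 - x.1))))).Finite := by
  obtain ⟨K, hK⟩ := B.coeff_bounded
  refine ((Set.finite_Iic (K - r - 1).toNat).prod
    (Set.finite_Iic (K - r - 1).toNat)).subset ?_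
  rintro ⟨p, q⟩ hx
  have h1 : r + p + 1 ≤ K := by
    by_contra h
    exact hx (by simp [hK (r + p + 1) (by omega)])
  have h2 : q ≤ p := by
    by_contra h
    exact hx (by simp [Nat.choose_eq_zero_of_lt (by omega : p < q)])
  simp only [Set.mem_prod, Set.mem_Iic]
  omega

end PseudoDiffOp

/-- The matrix pseudodifferential operator `A(∂)` is of Adler type with respect to the
`λ`-bracket `L`: for all `i, j, h, k`,
`{A_ij(z)_λ A_hk(w)} = A_hj(w+λ+∂) ι_z(z-w-λ-∂)⁻¹ (A_ik)^*(λ-z) - A_hj(z) ι_z(z-w-λ-∂)⁻¹ A_ik(w)`,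
as an equality of the coefficients of all monomials `z^r w^s`. -/
def IsAdlerType {d : Derivation F V V} (L : LambdaBracket d) {m n : Type*}
    (A : Matrix m n (PseudoDiffOp d)) : Prop :=
  ∀ (i : m) (j : n) (h : m) (k : n) (r s : ℤ),
    L.br ((A i j).coeff r) ((A h k).coeff s) =
      PseudoDiffOp.adlerFst (A h j) (A i k) r s - PseudoDiffOp.adlerSnd (A h j) (A i k) r s

/-- `B` is the two-sided inverse of the square matrix pseudodifferential operator `A`. -/
def IsInverse {d : Derivation F V V} {n : Type*} [Fintype n] [DecidableEq n]
    (A B : Matrix n n (PseudoDiffOp d)) : Prop :=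
  A * B = 1 ∧ B * A = 1

/-- The generalized quasideterminant `|A|_{IJ} = (J A⁻¹ I)⁻¹` exists and is equal to `Q`:
`A` has an inverse `B`, and `J B I` has the inverse `Q`. -/
def IsQuasideterminant {d : Derivation F V V} {m n : Type*} [Fintype m] [DecidableEq m]
    [Fintype n] [DecidableEq n] (A : Matrix n n (PseudoDiffOp d))
    (I : Matrix n m (PseudoDiffOp d)) (J : Matrix m n (PseudoDiffOp d))
    (Q : Matrix m m (PseudoDiffOp d)) : Prop :=
  ∃ B : Matrix n n (PseudoDiffOp d), IsInverse A B ∧ IsInverse (J * B * I) Q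

end AdlerType

end

/-!
Every `f` turns the `λ`-bracket into the derivations `{a_∂ ·} f`, which commute with `∂`. For
coefficients `a` of `A` and `f` of a test operator `P` they add up to a derivation `δ_P`, dual to
`A` under the residue pairing, and the Adler identity, with both sides applied to `f`, becomes the
Adler–Gelfand–Dickey identity `δ_P A = A (PA)_+ - (AP)_+ A`. Since the pairing is cyclic, constant
matrices can be moved across it, so the identity passes from `A` to `J A I`. Differentiating
`A A⁻¹ = 1` shows that it passes from `A` to `A⁻¹` up to a sign, and the two inversions in
`(J A⁻¹ I)⁻¹` cancel the sign. The Adler identity, which is about polynomials in `λ`, is recovered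
by taking the coefficients of `P` in the square-zero extension `V ⊕ V[λ] ε` with `∂ε = λε`, where
`P(∂) ε = P ε`.
-/

noncomputable section

namespace AdlerType

theorem finite_support_of_forall_nat_lt {M : Type*} [Zero M] {g : ℕ → M} (b : ℤ)
    (hb : ∀ n : ℕ, b < n → g n = 0) : (Function.support g).Finite :=
  (Set.finite_Iic b.toNat).subset fun n hn => by
    by_contra h
    exact hn (hb n (by simp only [Set.mem_Iic] at h; lia))

theorem finite_support_of_forall_int_lt {M : Type*} [Zero M] {g : ℤ → M} (a b : ℤ)
    (ha : ∀ n < a, g n = 0) (hb : ∀ n, b < n → g n = 0) : (Function.support g).Finite :=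
  (Set.finite_Icc a b).subset fun n hn =>
    ⟨not_lt.mp fun h => hn (ha n h), not_lt.mp fun h => hn (hb n h)⟩

theorem finsum_eq_finsum_comp {α β M : Type*} [AddCommMonoid M] {g : α → β}
    (hg : Function.Injective g) {f : β → M} (hf : Function.support f ⊆ Set.range g) :
    ∑ᶠ b, f b = ∑ᶠ a, f (g a) := by
  rw [← finsum_mem_range hg, ← finsum_mem_support]
  exact finsum_mem_inter_support_eq' f _ _ fun x hx => ⟨fun _ => hf hx, fun _ => hx⟩

theorem finsum_int_eq_finsum_nat_add {M : Type*} [AddCommMonoid M] {f : ℤ → M} (a : ℤ)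
    (hf : ∀ n < a, f n = 0) : ∑ᶠ n, f n = ∑ᶠ k : ℕ, f (a + k) :=
  finsum_eq_finsum_comp (fun k l hkl => by simpa using hkl) fun n hn =>
    ⟨(n - a).toNat, by have := not_lt.mp fun h => hn (hf n h); lia⟩

theorem finsum_int_eq_finsum_nat_sub {M : Type*} [AddCommMonoid M] {f : ℤ → M} (a : ℤ)
    (hf : ∀ n, a < n → f n = 0) : ∑ᶠ n, f n = ∑ᶠ k : ℕ, f (a - k) :=
  finsum_eq_finsum_comp (fun k l hkl => by simpa using hkl) fun n hn =>
    ⟨(a - n).toNat, by have := not_lt.mp fun h => hn (hf n h); lia⟩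

theorem choose_eq_zero_of_nonneg_of_lt {m : ℤ} {k : ℕ} (h0 : 0 ≤ m) (h : m < k) :
    Ring.choose m k = 0 := by
  lift m to ℕ using h0
  rw [Ring.choose_natCast, Nat.choose_eq_zero_of_lt (by lia), Nat.cast_zero]

namespace PseudoDiffOp

variable {F V : Type*} [Field F] [CommRing V] [Algebra F V] {d : Derivation F V V}

@[ext] theorem ext {A B : PseudoDiffOp d} (h : ∀ n, A.coeff n = B.coeff n) : A = B :=
  Subtype.ext (funext h)

@[simp] theorem coeff_zero (n : ℤ) : (0 : PseudoDiffOp d).coeff n = 0 := rfl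

@[simp] theorem coeff_add (A B : PseudoDiffOp d) (n : ℤ) :
    (A + B).coeff n = A.coeff n + B.coeff n := rfl

@[simp] theorem coeff_sub (A B : PseudoDiffOp d) (n : ℤ) :
    (A - B).coeff n = A.coeff n - B.coeff n := rfl

/-- `A` has order at most `N`, i.e. `A = ∑_{n ≤ N} a_n ∂^n`. -/
def OrderLE (A : PseudoDiffOp d) (N : ℤ) : Prop := ∀ n, N < n → A.coeff n = 0

theorem exists_orderLE (A : PseudoDiffOp d) : ∃ N, A.OrderLE N := A.coeff_bounded

/-- The monomial `a ∂^m`. -/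
def single (d : Derivation F V V) (m : ℤ) (a : V) : PseudoDiffOp d :=
  ⟨fun n => if n = m then a else 0, m, fun _ hn => if_neg hn.ne'⟩

theorem coeff_single (m : ℤ) (a : V) (n : ℤ) :
    (single d m a).coeff n = if n = m then a else 0 := rfl

@[simp] theorem coeff_single_same (m : ℤ) (a : V) : (single d m a).coeff m = a := if_pos rfl

theorem coeff_single_of_ne {m n : ℤ} (h : n ≠ m) (a : V) : (single d m a).coeff n = 0 := if_neg h

theorem single_zero_right (m : ℤ) : single d m 0 = 0 := ext fun _ => ite_self 0

theorem single_add (m : ℤ) (a b : V) : single d m (a + b) = single d m a + single d m b := by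
  ext n
  simp only [coeff_single, coeff_add]
  split_ifs <;> simp

theorem const_eq_single (c : F) : const d c = single d 0 (algebraMap F V c) := rfl

theorem const_zero : const d 0 = 0 := by rw [const_eq_single, map_zero, single_zero_right]

theorem one_eq_single : (1 : PseudoDiffOp d) = single d 0 1 := by
  rw [← map_one (algebraMap F V)]
  rfl

theorem orderLE_single (m : ℤ) (a : V) : (single d m a).OrderLE m := fun _ hn => if_neg hn.ne'

theorem order_induction {p : PseudoDiffOp d → Prop} (N : ℤ) (low : ∀ A, A.OrderLE N → p A)
    (add : ∀ A B, p A → p B → p (A + B))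
    (lead : ∀ m a, ∃ E, p E ∧ (E - single d m a).OrderLE (m - 1)) (A : PseudoDiffOp d) : p A := by
  have key (k : ℕ) : ∀ A : PseudoDiffOp d, A.OrderLE (N + k) → p A := by
    induction k with
    | zero => exact fun A hA => low A (by simpa using hA)
    | succ k ih =>
      intro A hA
      obtain ⟨E, hE, hlead⟩ := lead (N + k + 1) (A.coeff (N + k + 1))
      rw [← add_sub_cancel E A]
      refine add _ _ hE (ih _ fun n hn => ?_)
      have hEn := hlead n (by lia)
      rw [coeff_sub, sub_eq_zero] at hEn
      rw [coeff_sub, hEn, sub_eq_zero]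
      rcases eq_or_ne n (N + k + 1) with rfl | h
      · rw [coeff_single_same]
      · rw [coeff_single_of_ne h, hA n (by push_cast; lia)]
  obtain ⟨K, hK⟩ := A.exists_orderLE
  exact key (K - N).toNat A fun n hn => hK n (by lia)

@[elab_as_elim]
theorem single_induction {p : PseudoDiffOp d → Prop} (N : ℤ) (A : PseudoDiffOp d)
    (low : ∀ A, A.OrderLE N → p A) (add : ∀ A B, p A → p B → p (A + B))
    (single : ∀ m a, p (single d m a)) : p A :=
  order_induction N low add (fun m a => ⟨_, single m a, by rw [sub_self]; exact fun _ _ => rfl⟩) A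

/-! ### The ring of pseudodifferential operators -/

theorem finite_support_derivPow (m : ℤ) (B : PseudoDiffOp d) (n : ℤ) :
    (Function.support fun k : ℕ => Ring.choose m k •
      ((d : V →ₗ[F] V) ^ k) (B.coeff (n - m + k))).Finite := by
  obtain ⟨K, hK⟩ := B.exists_orderLE
  refine finite_support_of_forall_nat_lt (K - n + m) fun k hk => ?_
  rw [hK _ (by lia), map_zero, smul_zero]

/-- The left multiplication `B ↦ ∂^m ∘ B`. -/
def derivPow (m : ℤ) : PseudoDiffOp d →+ PseudoDiffOp d where
  toFun B := ⟨fun n => ∑ᶠ k : ℕ, Ring.choose m k • ((d : V →ₗ[F] V) ^ k) (B.coeff (n - m + k)), by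
    obtain ⟨K, hK⟩ := B.coeff_bounded
    refine ⟨m + K, fun n hn => finsum_eq_zero_of_forall_eq_zero fun k => ?_⟩
    rw [hK _ (by lia), map_zero, smul_zero]⟩
  map_zero' := by
    ext n
    exact finsum_eq_zero_of_forall_eq_zero fun k => by simp
  map_add' A B := by
    ext n
    refine Eq.trans ?_ (finsum_add_distrib (finite_support_derivPow m A n)
      (finite_support_derivPow m B n))
    exact finsum_congr fun k => by simp

theorem coeff_derivPow (m : ℤ) (B : PseudoDiffOp d) (n : ℤ) : (derivPow m B).coeff n =
    ∑ᶠ k : ℕ, Ring.choose m k • ((d : V →ₗ[F] V) ^ k) (B.coeff (n - m + k)) := rfl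

theorem OrderLE.derivPow {B : PseudoDiffOp d} {K : ℤ} (hB : B.OrderLE K) (m : ℤ) :
    (derivPow m B).OrderLE (m + K) := fun n hn =>
  finsum_eq_zero_of_forall_eq_zero fun k => by rw [hB _ (by lia), map_zero, smul_zero]

theorem OrderLE.coeff_derivPow {B : PseudoDiffOp d} {K : ℤ} (hB : B.OrderLE K) {m n : ℤ} {l : ℕ}
    (hl : K < n - m + l) : (PseudoDiffOp.derivPow m B).coeff n =
      ∑ k ∈ Finset.range l, Ring.choose m k • ((d : V →ₗ[F] V) ^ k) (B.coeff (n - m + k)) :=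
  finsum_eq_sum_of_support_subset _ fun k hk => by
    by_contra h
    rw [Finset.mem_coe, Finset.mem_range] at h
    exact hk (by beta_reduce; rw [hB _ (by lia), map_zero, smul_zero])

theorem coeff_derivPow_single (m r : ℤ) (a : V) {n : ℤ} {k : ℕ} (h : n + k = m + r) :
    (derivPow m (single d r a)).coeff n = Ring.choose m k • ((d : V →ₗ[F] V) ^ k) a := by
  rw [coeff_derivPow, finsum_eq_single _ k, coeff_single, if_pos (by lia)]
  intro l hl
  rw [coeff_single_of_ne (by lia), map_zero, smul_zero]

theorem derivPow_zero (B : PseudoDiffOp d) : derivPow 0 B = B := by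
  ext n
  rw [coeff_derivPow, finsum_eq_single _ 0 fun k hk => by
    rw [Ring.choose_zero_pos ℤ (Nat.pos_of_ne_zero hk), zero_smul]]
  simp

theorem coeff_derivPow_one (B : PseudoDiffOp d) (n : ℤ) :
    (derivPow 1 B).coeff n = B.coeff (n - 1) + d (B.coeff n) := by
  rw [coeff_derivPow, finsum_eq_sum_of_support_subset (s := Finset.range 2)]
  · simp [Finset.sum_range_succ]
  · intro k hk
    by_contra h
    rw [Finset.mem_coe, Finset.mem_range] at h
    exact hk (by beta_reduce; rw [choose_eq_zero_of_nonneg_of_lt zero_le_one (by lia), zero_smul])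

-- The Chu–Vandermonde identity for the coefficients `binom(m, k)`.
theorem derivPow_derivPow (m n : ℤ) (B : PseudoDiffOp d) :
    derivPow m (derivPow n B) = derivPow (m + n) B := by
  ext t
  obtain ⟨K, hK⟩ := B.exists_orderLE
  obtain ⟨l, hl⟩ : ∃ l : ℕ, K < t - (m + n) + l := ⟨(K - t + (m + n) + 1).toNat, by lia⟩
  rw [(hK.derivPow n).coeff_derivPow (l := l) (by lia), hK.coeff_derivPow hl]
  calc ∑ k ∈ Finset.range l, Ring.choose m k •
        ((d : V →ₗ[F] V) ^ k) ((derivPow n B).coeff (t - m + k))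
      = ∑ k ∈ Finset.range l, ∑ j ∈ Finset.range (l - k), (Ring.choose m k * Ring.choose n j) •
        ((d : V →ₗ[F] V) ^ (k + j)) (B.coeff (t - (m + n) + (k + j : ℕ))) := by
        refine Finset.sum_congr rfl fun k hk => ?_
        rw [Finset.mem_range] at hk
        rw [hK.coeff_derivPow (l := l - k) (by lia), map_sum, Finset.smul_sum]
        refine Finset.sum_congr rfl fun j _ => ?_
        rw [map_zsmul, smul_smul, pow_add, Module.End.mul_apply,
          show t - m + k - n + j = t - (m + n) + (k + j : ℕ) by push_cast; ring]
    _ = ∑ i ∈ Finset.range l, Ring.choose (m + n) i •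
        ((d : V →ₗ[F] V) ^ i) (B.coeff (t - (m + n) + i)) := by
        rw [← Finset.sum_range_diag_flip l fun k j => (Ring.choose m k * Ring.choose n j) •
          ((d : V →ₗ[F] V) ^ (k + j)) (B.coeff (t - (m + n) + (k + j : ℕ)))]
        refine Finset.sum_congr rfl fun i _ => ?_
        rw [Ring.add_choose_eq i (Commute.all m n),
          Finset.Nat.sum_antidiagonal_eq_sum_range_succ_mk, Finset.sum_smul]
        refine Finset.sum_congr rfl fun k hk => ?_
        rw [Nat.add_sub_cancel' (Finset.mem_range_succ_iff.mp hk)]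

theorem coeff_mul (A B : PseudoDiffOp d) (n : ℤ) :
    (A * B).coeff n = ∑ᶠ m : ℤ, A.coeff m * (derivPow m B).coeff n := by
  refine (finsum_curry _ (finite_support_mul A B n)).trans (finsum_congr fun m => ?_)
  rw [coeff_derivPow, mul_finsum' _ _ (finite_support_derivPow m B n)]
  exact finsum_congr fun k => (mul_smul_comm _ _ _).symm

theorem finite_support_coeff_mul (A B : PseudoDiffOp d) (n : ℤ) :
    (Function.support fun m : ℤ => A.coeff m * (derivPow m B).coeff n).Finite := by
  obtain ⟨N, hN⟩ := A.exists_orderLE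
  obtain ⟨K, hK⟩ := B.exists_orderLE
  refine finite_support_of_forall_int_lt (n - K) N (fun m hm => ?_) fun m hm => ?_
  · rw [hK.derivPow m n (by lia), mul_zero]
  · rw [hN m hm, zero_mul]

theorem OrderLE.mul {A B : PseudoDiffOp d} {N K : ℤ} (hA : A.OrderLE N) (hB : B.OrderLE K) :
    (A * B).OrderLE (N + K) := fun n hn => by
  rw [coeff_mul]
  refine finsum_eq_zero_of_forall_eq_zero fun m => ?_
  rcases lt_or_ge N m with h | h
  · rw [hA m h, zero_mul]
  · rw [hB.derivPow m n (by lia), mul_zero]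

theorem coeff_single_mul (m : ℤ) (a : V) (B : PseudoDiffOp d) (n : ℤ) :
    (single d m a * B).coeff n = a * (derivPow m B).coeff n := by
  rw [coeff_mul, finsum_eq_single _ m fun k hk => by rw [coeff_single_of_ne hk, zero_mul],
    coeff_single_same]

theorem derivPow_one_right (m : ℤ) : derivPow m (1 : PseudoDiffOp d) = single d m 1 := by
  ext n
  rw [one_eq_single]
  rcases lt_trichotomy n m with h | rfl | h
  · obtain ⟨k, hk⟩ : ∃ k : ℕ, n + (k + 1 : ℕ) = m + 0 := ⟨(m - n - 1).toNat, by lia⟩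
    rw [coeff_derivPow_single m 0 1 hk, coeff_single_of_ne h.ne, pow_succ, Module.End.mul_apply]
    simp
  · rw [coeff_derivPow_single n 0 1 (k := 0) (by simp)]
    simp
  · rw [(orderLE_single 0 1).derivPow m n (by lia), coeff_single_of_ne h.ne']

protected theorem add_mul (A B C : PseudoDiffOp d) : (A + B) * C = A * C + B * C := by
  ext n
  simp only [coeff_mul, coeff_add, add_mul]
  exact finsum_add_distrib (finite_support_coeff_mul A C n) (finite_support_coeff_mul B C n)

protected theorem mul_add (A B C : PseudoDiffOp d) : A * (B + C) = A * B + A * C := by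
  ext n
  simp only [coeff_mul, coeff_add, map_add, mul_add]
  exact finsum_add_distrib (finite_support_coeff_mul A B n) (finite_support_coeff_mul A C n)

protected theorem one_mul (A : PseudoDiffOp d) : 1 * A = A := by
  ext n
  rw [one_eq_single, coeff_single_mul, derivPow_zero, one_mul]

protected theorem mul_one (A : PseudoDiffOp d) : A * 1 = A := by
  ext n
  rw [coeff_mul, finsum_eq_single _ n, derivPow_one_right, coeff_single_same, mul_one]
  intro m hm
  rw [derivPow_one_right, coeff_single_of_ne hm.symm, mul_zero]

theorem derivPow_one_single (m : ℤ) (b : V) :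
    derivPow 1 (single d m b) = single d (m + 1) b + single d m (d b) := by
  ext n
  simp only [coeff_derivPow_one, coeff_add, coeff_single, sub_eq_iff_eq_add]
  split_ifs <;> simp

theorem derivPow_one_mul (B C : PseudoDiffOp d) : derivPow 1 B * C = derivPow 1 (B * C) := by
  ext n
  obtain ⟨K, hK⟩ := C.exists_orderLE
  induction B using single_induction (n - K - 2) with
  | low B hB => rw [(hB.derivPow 1).mul hK n (by lia), (hB.mul hK).derivPow 1 n (by lia)]
  | add A B hA hB =>
    rw [map_add, PseudoDiffOp.add_mul, PseudoDiffOp.add_mul, map_add, coeff_add, hA, hB, coeff_add]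
  | single m b =>
    rw [derivPow_one_single, PseudoDiffOp.add_mul, coeff_add, coeff_derivPow_one]
    simp only [coeff_single_mul]
    rw [add_comm m 1, ← derivPow_derivPow, coeff_derivPow_one, Derivation.leibniz]
    simp only [smul_eq_mul]
    ring

theorem derivPow_injective (m : ℤ) : Function.Injective (derivPow (d := d) m) := fun A B h => by
  rw [← derivPow_zero A, ← neg_add_cancel m, ← derivPow_derivPow, h, derivPow_derivPow,
    neg_add_cancel, derivPow_zero]

theorem derivPow_mul (m : ℤ) (B C : PseudoDiffOp d) : derivPow m B * C = derivPow m (B * C) := by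
  induction m with
  | zero => rw [derivPow_zero, derivPow_zero]
  | succ m ih =>
    rw [add_comm, ← derivPow_derivPow, derivPow_one_mul, ih, derivPow_derivPow]
  | pred m ih =>
    apply derivPow_injective 1
    rw [← derivPow_one_mul, derivPow_derivPow, derivPow_derivPow, add_sub_cancel, ih]

theorem single_mul_mul (m : ℤ) (a : V) (B C : PseudoDiffOp d) :
    single d m a * B * C = single d m a * (B * C) := by
  ext n
  rw [coeff_single_mul, ← derivPow_mul, coeff_mul, coeff_mul,
    mul_finsum' _ _ (finite_support_coeff_mul _ C n)]
  exact finsum_congr fun k => by rw [coeff_single_mul, mul_assoc]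

protected theorem mul_assoc (A B C : PseudoDiffOp d) : A * B * C = A * (B * C) := by
  ext n
  obtain ⟨K, hK⟩ := B.exists_orderLE
  obtain ⟨L, hL⟩ := C.exists_orderLE
  induction A using single_induction (n - K - L - 1) with
  | low A hA => rw [(hA.mul hK).mul hL n (by lia), hA.mul (hK.mul hL) n (by lia)]
  | add X Y hX hY => simp only [PseudoDiffOp.add_mul, coeff_add, hX, hY]
  | single m b => rw [single_mul_mul]

instance : Ring (PseudoDiffOp d) where
  __ := (inferInstance : AddCommGroup (PseudoDiffOp d))
  left_distrib := PseudoDiffOp.mul_add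
  right_distrib := PseudoDiffOp.add_mul
  zero_mul A := by simpa using PseudoDiffOp.add_mul 0 0 A
  mul_zero A := by simpa using PseudoDiffOp.mul_add A 0 0
  mul_assoc := PseudoDiffOp.mul_assoc
  one_mul := PseudoDiffOp.one_mul
  mul_one := PseudoDiffOp.mul_one

theorem coeff_single_zero_mul (a : V) (B : PseudoDiffOp d) (n : ℤ) :
    (single d 0 a * B).coeff n = a * B.coeff n := by
  rw [coeff_single_mul, derivPow_zero]

theorem single_one_mul (m : ℤ) (B : PseudoDiffOp d) : single d m 1 * B = derivPow m B := by
  ext n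
  rw [coeff_single_mul, one_mul]

theorem single_mul_single_one (m r : ℤ) (a : V) :
    single d m a * single d r 1 = single d (m + r) a := by
  ext n
  rw [coeff_single_mul, ← derivPow_one_right, derivPow_derivPow, derivPow_one_right, coeff_single,
    coeff_single]
  split_ifs <;> simp

theorem coeff_mul_single_one (A : PseudoDiffOp d) (r n : ℤ) :
    (A * single d r 1).coeff n = A.coeff (n - r) := by
  have hcoeff (m : ℤ) : (derivPow m (single d r 1)).coeff n = if n = m + r then 1 else 0 := by
    rw [← single_one_mul, single_mul_single_one, coeff_single]
  rw [coeff_mul, finsum_eq_single _ (n - r), hcoeff, if_pos (by ring), mul_one]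
  intro m hm
  rw [hcoeff, if_neg (by lia), mul_zero]

/-! ### Residues and differential parts -/

/-- The residue `Res A = a_{-1}` of `A = ∑_n a_n ∂^n`. -/
def residue : PseudoDiffOp d →+ V where
  toFun A := A.coeff (-1)
  map_zero' := rfl
  map_add' _ _ := rfl

theorem residue_apply (A : PseudoDiffOp d) : residue A = A.coeff (-1) := rfl

theorem residue_mul (A B : PseudoDiffOp d) :
    residue (A * B) = ∑ᶠ m : ℤ, A.coeff m * residue (derivPow m B) := coeff_mul A B (-1)

theorem OrderLE.residue_derivPow {A : PseudoDiffOp d} {K m : ℤ} (hA : A.OrderLE K)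
    (hm : m + K < -1) : residue (PseudoDiffOp.derivPow m A) = 0 := hA.derivPow m (-1) hm

theorem residue_derivPow_single_zero (m : ℤ) (a : V) :
    residue (derivPow m (single d 0 a)) = if m = -1 then a else 0 := by
  rw [residue_apply]
  split_ifs with h
  · rw [coeff_derivPow_single m 0 a (k := 0) (by simp [h])]
    simp
  · rcases lt_or_ge m 0 with hm | hm
    · exact (orderLE_single 0 a).derivPow m (-1) (by lia)
    · rw [coeff_derivPow_single m 0 a (k := (m + 1).toNat) (by lia),
        choose_eq_zero_of_nonneg_of_lt hm (by lia), zero_smul]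

theorem residue_mul_single_zero (A : PseudoDiffOp d) (a : V) :
    residue (A * single d 0 a) = residue A * a := by
  rw [residue_mul, finsum_eq_single _ (-1), residue_derivPow_single_zero, if_pos rfl, residue_apply]
  intro m hm
  rw [residue_derivPow_single_zero, if_neg hm, mul_zero]

theorem orderLE_derivPow_single_zero_sub (m : ℤ) (a : V) :
    (derivPow m (single d 0 a) - single d m a).OrderLE (m - 1) := fun n hn => by
  rw [coeff_sub]
  rcases eq_or_ne n m with rfl | h
  · rw [coeff_derivPow_single n 0 a (k := 0) (by simp)]
    simp
  · rw [(orderLE_single 0 a).derivPow m n (by lia), coeff_single_of_ne h, sub_zero]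

@[elab_as_elim]
theorem derivPow_single_induction {p : PseudoDiffOp d → Prop} (N : ℤ) (A : PseudoDiffOp d)
    (low : ∀ A, A.OrderLE N → p A) (add : ∀ A B, p A → p B → p (A + B))
    (derivPow_single : ∀ m a, p (derivPow m (single d 0 a))) : p A :=
  order_induction N low add
    (fun m a => ⟨_, derivPow_single m a, orderLE_derivPow_single_zero_sub m a⟩) A

/-- The differential part `A_+ = ∑_{n ≥ 0} a_n ∂^n` of `A = ∑_n a_n ∂^n`. -/
def diffPart : PseudoDiffOp d →+ PseudoDiffOp d where
  toFun A := ⟨fun n => if 0 ≤ n then A.coeff n else 0, by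
    obtain ⟨N, hN⟩ := A.coeff_bounded
    exact ⟨N, fun n hn => by simp only [hN n hn, ite_self]⟩⟩
  map_zero' := ext fun _ => ite_self 0
  map_add' A B := by
    ext n
    change (if 0 ≤ n then A.coeff n + B.coeff n else 0) =
      (if 0 ≤ n then A.coeff n else 0) + if 0 ≤ n then B.coeff n else 0
    split_ifs <;> simp

theorem coeff_diffPart_of_nonneg (A : PseudoDiffOp d) {n : ℤ} (hn : 0 ≤ n) :
    (diffPart A).coeff n = A.coeff n := if_pos hn

theorem coeff_diffPart_of_neg (A : PseudoDiffOp d) {n : ℤ} (hn : n < 0) :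
    (diffPart A).coeff n = 0 := if_neg hn.not_ge

theorem OrderLE.diffPart_eq_zero {A : PseudoDiffOp d} {N : ℤ} (hA : A.OrderLE N) (hN : N < 0) :
    diffPart A = 0 := by
  ext n
  rcases lt_or_ge n 0 with hn | hn
  · exact coeff_diffPart_of_neg A hn
  · rw [coeff_diffPart_of_nonneg A hn, hA n (by lia), coeff_zero]

theorem diffPart_single_zero_mul (a : V) (A : PseudoDiffOp d) :
    diffPart (single d 0 a * A) = single d 0 a * diffPart A := by
  ext n
  rw [coeff_single_zero_mul]
  rcases lt_or_ge n 0 with hn | hn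
  · rw [coeff_diffPart_of_neg _ hn, coeff_diffPart_of_neg _ hn, mul_zero]
  · rw [coeff_diffPart_of_nonneg _ hn, coeff_diffPart_of_nonneg _ hn, coeff_single_zero_mul]

theorem coeff_derivPow_single_zero_of_neg {m n : ℤ} (hm : 0 ≤ m) (hn : n < 0) (a : V) :
    (derivPow m (single d 0 a)).coeff n = 0 := by
  rw [coeff_derivPow_single m 0 a (k := (m - n).toNat) (by lia),
    choose_eq_zero_of_nonneg_of_lt hm (by lia), zero_smul]

theorem diffPart_derivPow_single_zero_of_nonneg {m : ℤ} (hm : 0 ≤ m) (a : V) :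
    diffPart (derivPow m (single d 0 a)) = derivPow m (single d 0 a) := by
  ext n
  rcases lt_or_ge n 0 with hn | hn
  · rw [coeff_diffPart_of_neg _ hn, coeff_derivPow_single_zero_of_neg hm hn]
  · exact coeff_diffPart_of_nonneg _ hn

theorem diffPart_mul_single_zero (A : PseudoDiffOp d) (a : V) :
    diffPart (A * single d 0 a) = diffPart A * single d 0 a := by
  ext n
  rw [coeff_mul]
  rcases lt_or_ge n 0 with hn | hn
  · rw [coeff_diffPart_of_neg _ hn, finsum_eq_zero_of_forall_eq_zero]
    intro m
    rcases lt_or_ge m 0 with hm | hm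
    · rw [coeff_diffPart_of_neg _ hm, zero_mul]
    · rw [coeff_derivPow_single_zero_of_neg hm hn, mul_zero]
  · rw [coeff_diffPart_of_nonneg _ hn, coeff_mul]
    refine finsum_congr fun m => ?_
    rcases lt_or_ge m 0 with hm | hm
    · rw [(orderLE_single 0 a).derivPow m n (by lia), mul_zero, mul_zero]
    · rw [coeff_diffPart_of_nonneg _ hm]

theorem coeff_diffPart_mul (A B : PseudoDiffOp d) (s : ℤ) :
    (diffPart A * B).coeff s = ∑ᶠ p : ℕ, A.coeff p * (derivPow p B).coeff s := by
  rw [coeff_mul, finsum_int_eq_finsum_nat_add 0]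
  · refine finsum_congr fun p => ?_
    rw [zero_add, coeff_diffPart_of_nonneg A p.cast_nonneg]
  · intro n hn
    rw [coeff_diffPart_of_neg A hn, zero_mul]

theorem coeff_mul_derivPow_single_zero (B : PseudoDiffOp d) (p : ℤ) (a : V) (s : ℤ) :
    (B * derivPow p (single d 0 a)).coeff s = ∑ᶠ q : ℕ, Ring.choose (s + q) q •
      (B.coeff (s + q - p) * ((d : V →ₗ[F] V) ^ q) a) := by
  rw [coeff_mul, finsum_int_eq_finsum_nat_add (s - p)]
  · refine finsum_congr fun q => ?_
    rw [derivPow_derivPow, coeff_derivPow_single _ 0 a (k := q) (by ring), mul_smul_comm,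
      show s - p + (q : ℤ) = s + q - p by ring, sub_add_cancel]
  · intro n hn
    rw [derivPow_derivPow, (orderLE_single 0 a).derivPow _ s (by lia), mul_zero]

theorem finite_support_coeff_mul_derivPow_residue (B A : PseudoDiffOp d) (s : ℤ) :
    (Function.support fun p : ℕ =>
      (B * derivPow p (single d 0 (residue (derivPow (-p - 1) A)))).coeff s).Finite := by
  obtain ⟨K, hK⟩ := A.exists_orderLE
  refine finite_support_of_forall_nat_lt K fun p hp => ?_
  rw [hK.residue_derivPow (by lia), single_zero_right, map_zero, mul_zero, coeff_zero]

-- Written with coefficients on the right, `A_+ = ∑_{p ≥ 0} ∂^p ∘ Res(∂^{-p-1} ∘ A)`.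
theorem coeff_mul_diffPart (B A : PseudoDiffOp d) (s : ℤ) : (B * diffPart A).coeff s =
    ∑ᶠ p : ℕ, (B * derivPow p (single d 0 (residue (derivPow (-p - 1) A)))).coeff s := by
  have residue_eq_zero {p : ℕ} {a : V} (ha : a = 0) :
      (B * derivPow p (single d 0 a)).coeff s = 0 := by
    rw [ha, single_zero_right, map_zero, mul_zero, coeff_zero]
  induction A using derivPow_single_induction (-1) with
  | low A hA =>
    rw [hA.diffPart_eq_zero (by lia), mul_zero, coeff_zero, finsum_eq_zero_of_forall_eq_zero]
    exact fun p => residue_eq_zero (hA.residue_derivPow (by lia))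
  | add X Y hX hY =>
    rw [map_add, mul_add, coeff_add, hX, hY, ← finsum_add_distrib
      (finite_support_coeff_mul_derivPow_residue B X s)
      (finite_support_coeff_mul_derivPow_residue B Y s)]
    refine finsum_congr fun p => ?_
    rw [map_add, map_add, single_add, map_add, mul_add, coeff_add]
  | derivPow_single m a =>
    simp only [derivPow_derivPow, residue_derivPow_single_zero]
    rcases lt_or_ge m 0 with hm | hm
    · rw [((orderLE_single 0 a).derivPow m).diffPart_eq_zero (by lia), mul_zero, coeff_zero,
        finsum_eq_zero_of_forall_eq_zero]
      exact fun p => residue_eq_zero (if_neg (by lia))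
    · lift m to ℕ using hm
      rw [diffPart_derivPow_single_zero_of_nonneg m.cast_nonneg, finsum_eq_single _ m,
        if_pos (by ring)]
      exact fun p hp => residue_eq_zero (if_neg (by lia))

theorem coeff_adjoint (A : PseudoDiffOp d) (n : ℤ) :
    A.adjoint.coeff n = (n.negOnePow : ℤ) • residue (derivPow (-n - 1) A) := by
  rw [residue_apply, coeff_derivPow, smul_finsum' _ (finite_support_derivPow _ A _)]
  refine finsum_congr fun k => ?_
  rw [show -n - 1 = -(n + 1) by ring, Ring.choose_neg, smul_smul, Int.negOnePow_add,
    show n + 1 + (k : ℤ) - 1 = n + k by ring, show -1 - -(n + 1) + (k : ℤ) = n + k by ring]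
  congr 1
  simp only [Units.val_mul, Units.smul_def, smul_eq_mul]
  ring

end PseudoDiffOp

/-! ### The residue pairing -/

open PseudoDiffOp

section

variable {F V W : Type*} [Field F] [CommRing V] [Algebra F V] [CommRing W] [Algebra F W]
  {d : Derivation F V V} {e : Derivation F W W}

theorem map_deriv_pow {g : V →+ W} (hg : ∀ a, g (d a) = e (g a)) (k : ℕ) (a : V) :
    g (((d : V →ₗ[F] V) ^ k) a) = ((e : W →ₗ[F] W) ^ k) (g a) := by
  simp only [Module.End.pow_apply]
  exact (Function.Semiconj.iterate_right hg k) a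

namespace PseudoDiffOp

/-- The operator `∑_n g(a_n) ∂^n` obtained from `∑_n a_n ∂^n` by applying `g` to the
coefficients. -/
def mapCoeff (e : Derivation F W W) (g : V →+ W) : PseudoDiffOp d →+ PseudoDiffOp e where
  toFun A := ⟨fun n => g (A.coeff n), by
    obtain ⟨N, hN⟩ := A.coeff_bounded
    exact ⟨N, fun n hn => by simp only [hN n hn, map_zero]⟩⟩
  map_zero' := ext fun _ => map_zero g
  map_add' _ _ := ext fun _ => map_add g _ _

theorem coeff_mapCoeff (g : V →+ W) (A : PseudoDiffOp d) (n : ℤ) :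
    (mapCoeff e g A).coeff n = g (A.coeff n) := rfl

theorem mapCoeff_derivPow {g : V →+ W} (hg : ∀ a, g (d a) = e (g a)) (m : ℤ)
    (A : PseudoDiffOp d) : mapCoeff e g (derivPow m A) = derivPow m (mapCoeff e g A) := by
  ext n
  rw [coeff_mapCoeff, coeff_derivPow, coeff_derivPow, map_finsum g (finite_support_derivPow m A n)]
  exact finsum_congr fun k => by rw [map_zsmul, map_deriv_pow hg, coeff_mapCoeff]

variable {G : Type*} [AddCommGroup G]

theorem finite_support_pairing (Δ : V →+ W →+ G) (P : PseudoDiffOp e) (A : PseudoDiffOp d) :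
    (Function.support fun n : ℤ => Δ (A.coeff n) (residue (derivPow n P))).Finite := by
  obtain ⟨N, hN⟩ := A.exists_orderLE
  obtain ⟨K, hK⟩ := P.exists_orderLE
  refine finite_support_of_forall_int_lt (-1 - K) N (fun m hm => ?_) fun m hm => ?_
  · rw [hK.residue_derivPow (by lia), map_zero]
  · rw [hN m hm, map_zero, AddMonoidHom.zero_apply]

/-- The analogue of `∫ Res (P ∘ δA)`, where `Δ(a, f)` plays the role of `∫ f δa`. -/
def pairing (Δ : V →+ W →+ G) : PseudoDiffOp e →+ PseudoDiffOp d →+ G :=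
  AddMonoidHom.mk' (fun P => AddMonoidHom.mk'
    (fun A => ∑ᶠ n : ℤ, Δ (A.coeff n) (residue (derivPow n P))) fun A B => by
      rw [← finsum_add_distrib (finite_support_pairing Δ P A) (finite_support_pairing Δ P B)]
      simp only [coeff_add, map_add, AddMonoidHom.add_apply])
    fun P Q => AddMonoidHom.ext fun A => by
      refine Eq.trans ?_ (finsum_add_distrib (finite_support_pairing Δ P A)
        (finite_support_pairing Δ Q A))
      simp only [map_add, AddMonoidHom.mk'_apply]

theorem pairing_apply (Δ : V →+ W →+ G) (P : PseudoDiffOp e) (A : PseudoDiffOp d) :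
    pairing Δ P A = ∑ᶠ n : ℤ, Δ (A.coeff n) (residue (derivPow n P)) := rfl

theorem pairing_eq_zero (Δ : V →+ W →+ G) {P : PseudoDiffOp e} {A : PseudoDiffOp d} {N K : ℤ}
    (hP : P.OrderLE K) (hA : A.OrderLE N) (hNK : N + K < -1) : pairing Δ P A = 0 :=
  finsum_eq_zero_of_forall_eq_zero fun n => by
    rcases lt_or_ge N n with h | h
    · rw [hA n h, map_zero, AddMonoidHom.zero_apply]
    · rw [hP.residue_derivPow (by lia), map_zero]

theorem pairing_single (Δ : V →+ W →+ G) (P : PseudoDiffOp e) (m : ℤ) (a : V) :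
    pairing Δ P (single d m a) = Δ a (residue (derivPow m P)) := by
  rw [pairing_apply, finsum_eq_single _ m, coeff_single_same]
  intro n hn
  rw [coeff_single_of_ne hn, map_zero, AddMonoidHom.zero_apply]

theorem pairing_derivPow_single_zero (Δ : V →+ W →+ G) (r : ℤ) (f : W) (A : PseudoDiffOp d) :
    pairing Δ (derivPow (-r - 1) (single e 0 f)) A = Δ (A.coeff r) f := by
  rw [pairing_apply, finsum_eq_single _ r, derivPow_derivPow, residue_derivPow_single_zero,
    if_pos (by ring)]
  intro n hn
  rw [derivPow_derivPow, residue_derivPow_single_zero, if_neg (by lia), map_zero]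

end PseudoDiffOp

section DifferentialAlgebra

variable [Algebra V W]

/-- The rules satisfied by `Δ(a, f) = ∫ f δa`, for the variation `δ` and the integral `∫` modulo
total derivatives. -/
structure IsVariational (d : Derivation F V V) (e : Derivation F W W) {G : Type*} [AddCommGroup G]
    (Δ : V →+ W →+ G) : Prop where
  map_mul : ∀ a b f, Δ (a * b) f = Δ a (b • f) + Δ b (a • f)
  map_deriv : ∀ a f, Δ (d a) f = -Δ a (e f)
  map_algebraMap : ∀ (c : F) f, Δ (algebraMap F V c) f = 0

namespace PseudoDiffOp

variable {G : Type*} [AddCommGroup G] {Δ : V →+ W →+ G}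

theorem pairing_const (hΔ : IsVariational d e Δ) (P : PseudoDiffOp e) (c : F) :
    pairing Δ P (const d c) = 0 := by
  rw [const_eq_single, pairing_single, hΔ.map_algebraMap]

theorem pairing_derivPow_one (hΔ : IsVariational d e Δ) (P : PseudoDiffOp e)
    (B : PseudoDiffOp d) : pairing Δ P (derivPow 1 B) = pairing Δ (P * single e 1 1) B := by
  obtain ⟨K, hK⟩ := P.exists_orderLE
  induction B using single_induction (-3 - K) with
  | low B hB =>
    rw [pairing_eq_zero Δ hK (hB.derivPow 1) (by lia),
      pairing_eq_zero Δ (hK.mul (orderLE_single 1 1)) hB (by lia)]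
  | add A B hA hB => rw [map_add, map_add, map_add, hA, hB]
  | single m b =>
    rw [derivPow_one_single, map_add, pairing_single, pairing_single, pairing_single,
      hΔ.map_deriv, ← derivPow_mul, residue_apply (_ * _), coeff_mul_single_one, add_comm m 1,
      ← derivPow_derivPow, residue_apply (derivPow 1 _), coeff_derivPow_one,
      ← residue_apply, map_add, add_neg_cancel_right]

theorem pairing_derivPow (hΔ : IsVariational d e Δ) (m : ℤ) (P : PseudoDiffOp e)
    (B : PseudoDiffOp d) : pairing Δ P (derivPow m B) = pairing Δ (P * single e m 1) B := by
  induction m generalizing P with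
  | zero => rw [derivPow_zero, ← one_eq_single, mul_one]
  | succ m ih =>
    rw [add_comm, ← derivPow_derivPow, pairing_derivPow_one hΔ, ih, mul_assoc,
      single_mul_single_one]
  | pred m ih =>
    have hP : P = P * single e (-1) 1 * single e 1 1 := by
      rw [mul_assoc, single_mul_single_one, neg_add_cancel, ← one_eq_single, mul_one]
    nth_rw 1 [hP]
    rw [← pairing_derivPow_one hΔ, derivPow_derivPow, add_sub_cancel, ih, mul_assoc,
      single_mul_single_one, neg_add_eq_sub]

end PseudoDiffOp

/-! ### Base change and evolutionary derivations -/

/-- The derivations `δ : V → W` commuting with the total derivatives `d` and `e`. -/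
def evolutionary (d : Derivation F V V) (e : Derivation F W W) :
    AddSubgroup (Derivation F V W) where
  carrier := {δ | ∀ a, δ (d a) = e (δ a)}
  zero_mem' a := by simp
  add_mem' hδ hη a := by simp [hδ a, hη a]
  neg_mem' hδ a := by simp [hδ a]

namespace PseudoDiffOp

/-- The application of a derivation to all coefficients. -/
def derivMap (e : Derivation F W W) : Derivation F V W →+ PseudoDiffOp d →+ PseudoDiffOp e :=
  AddMonoidHom.mk' (fun δ => mapCoeff e (δ : V →ₗ[F] W).toAddMonoidHom) fun _ _ => rfl

theorem coeff_derivMap (δ : Derivation F V W) (A : PseudoDiffOp d) (n : ℤ) :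
    (derivMap e δ A).coeff n = δ (A.coeff n) := rfl

theorem derivMap_const (δ : Derivation F V W) (c : F) : derivMap e δ (const d c) = 0 := by
  ext n
  rw [coeff_derivMap, const_eq_single, coeff_single]
  split_ifs <;> simp

end PseudoDiffOp

/-- `(W, e)` is a differential algebra over `(V, d)`: the structure map `V → W` intertwines the
two derivations. -/
class IsDifferentialAlgebra (d : Derivation F V V) (e : Derivation F W W) : Prop where
  deriv_algebraMap (d e) : ∀ a, e (algebraMap V W a) = algebraMap V W (d a)

variable [IsDifferentialAlgebra d e]

theorem deriv_smul (d : Derivation F V V) [IsDifferentialAlgebra d e] (a : V) (f : W) :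
    e (a • f) = a • e f + d a • f := by
  rw [Algebra.smul_def a, Algebra.smul_def a, Algebra.smul_def (d a), Derivation.leibniz,
    IsDifferentialAlgebra.deriv_algebraMap d e, smul_eq_mul, smul_eq_mul, mul_comm f]

namespace PseudoDiffOp

/-- Extension of scalars of pseudodifferential operators from `(V, d)` to `(W, e)`. -/
def baseChange (e : Derivation F W W) [IsDifferentialAlgebra d e] :
    PseudoDiffOp d →+* PseudoDiffOp e where
  __ := mapCoeff e (algebraMap V W : V →+ W)
  map_one' := by
    ext n
    change algebraMap V W ((1 : PseudoDiffOp d).coeff n) = (1 : PseudoDiffOp e).coeff n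
    rw [one_eq_single, one_eq_single, coeff_single, coeff_single]
    split_ifs <;> simp
  map_mul' A B := by
    ext n
    change algebraMap V W ((A * B).coeff n) = _
    rw [coeff_mul, coeff_mul, map_finsum _ (finite_support_coeff_mul A B n)]
    refine finsum_congr fun m => ?_
    change _ = _ * (derivPow m (mapCoeff e (algebraMap V W : V →+ W) B)).coeff n
    rw [← mapCoeff_derivPow fun a => (IsDifferentialAlgebra.deriv_algebraMap d e a).symm, map_mul]
    rfl

@[simp] theorem coeff_baseChange (A : PseudoDiffOp d) (n : ℤ) :
    (baseChange e A).coeff n = algebraMap V W (A.coeff n) := rfl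

theorem residue_baseChange (A : PseudoDiffOp d) :
    residue (baseChange e A) = algebraMap V W (residue A) := rfl

theorem baseChange_derivPow (m : ℤ) (A : PseudoDiffOp d) :
    baseChange e (derivPow m A) = derivPow m (baseChange e A) :=
  mapCoeff_derivPow (fun a => (IsDifferentialAlgebra.deriv_algebraMap d e a).symm) m A

theorem baseChange_single (m : ℤ) (a : V) :
    baseChange e (single d m a) = single e m (algebraMap V W a) := by
  ext n
  rw [coeff_baseChange, coeff_single, coeff_single]
  split_ifs <;> simp

theorem baseChange_const [IsScalarTower F V W] (c : F) :
    baseChange e (const d c) = const e c := by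
  rw [const_eq_single, baseChange_single, ← IsScalarTower.algebraMap_apply, const_eq_single]

theorem OrderLE.baseChange {A : PseudoDiffOp d} {N : ℤ} (hA : A.OrderLE N) :
    (baseChange e A).OrderLE N := fun n hn => by rw [coeff_baseChange, hA n hn, map_zero]

end PseudoDiffOp

/-! ### Leibniz rules -/

namespace PseudoDiffOp

theorem derivMap_mul {δ : Derivation F V W} (hδ : δ ∈ evolutionary d e) (A B : PseudoDiffOp d) :
    derivMap e δ (A * B) = derivMap e δ A * baseChange e B + baseChange e A * derivMap e δ B := by
  ext n
  rw [coeff_derivMap, coeff_add, coeff_mul, coeff_mul, coeff_mul,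
    map_finsum δ (finite_support_coeff_mul A B n),
    ← finsum_add_distrib (finite_support_coeff_mul _ _ n) (finite_support_coeff_mul _ _ n)]
  refine finsum_congr fun m => ?_
  have hderivPow : derivPow m (derivMap e δ B) = derivMap e δ (derivPow m B) :=
    (mapCoeff_derivPow (g := (δ : V →ₗ[F] W).toAddMonoidHom) hδ m B).symm
  rw [Derivation.leibniz, hderivPow, ← baseChange_derivPow, Algebra.smul_def, Algebra.smul_def,
    add_comm, mul_comm (algebraMap V W ((derivPow m B).coeff n))]
  rfl

variable {G : Type*} [AddCommGroup G] {Δ : V →+ W →+ G}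

theorem pairing_single_zero_mul (hΔ : IsVariational d e Δ) (P : PseudoDiffOp e) (a : V)
    (B : PseudoDiffOp d) : pairing Δ P (single d 0 a * B) =
      pairing Δ (baseChange e B * P) (single d 0 a) +
        pairing Δ (P * baseChange e (single d 0 a)) B := by
  have hfin : (Function.support fun n => (baseChange e B).coeff n *
      residue (derivPow n P)).Finite := finite_support_coeff_mul (baseChange e B) P (-1)
  have hfin' : (Function.support fun n => Δ a ((baseChange e B).coeff n *
      residue (derivPow n P))).Finite :=
    hfin.subset (Function.support_comp_subset (map_zero (Δ a)) _)
  rw [pairing_single, derivPow_zero, residue_mul, map_finsum (Δ a) hfin, pairing_apply,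
    pairing_apply, ← finsum_add_distrib hfin' (finite_support_pairing Δ _ B)]
  refine finsum_congr fun n => ?_
  rw [coeff_single_zero_mul, hΔ.map_mul, ← derivPow_mul, baseChange_single,
    residue_mul_single_zero, coeff_baseChange, Algebra.smul_def, Algebra.smul_def,
    mul_comm _ (algebraMap V W a)]

/-- The Leibniz rule `δ(AB) = (δA) B + A δB` together with the cyclicity of the residue. -/
theorem pairing_mul (hΔ : IsVariational d e Δ) (P : PseudoDiffOp e) (A B : PseudoDiffOp d) :
    pairing Δ P (A * B) =
      pairing Δ (baseChange e B * P) A + pairing Δ (P * baseChange e A) B := by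
  obtain ⟨K, hK⟩ := P.exists_orderLE
  obtain ⟨N, hN⟩ := B.exists_orderLE
  induction A using single_induction (-2 - N - K) with
  | low A hA =>
    rw [pairing_eq_zero Δ hK (hA.mul hN) (by lia),
      pairing_eq_zero Δ (hN.baseChange.mul hK) hA (by lia),
      pairing_eq_zero Δ (hK.mul hA.baseChange) hN (by lia), add_zero]
  | add X Y hX hY =>
    rw [add_mul, map_add, map_add, map_add, mul_add, map_add, AddMonoidHom.add_apply, hX, hY]
    abel
  | single m a =>
    have hsingle : single d m a = single d 0 a * single d m 1 := by
      rw [single_mul_single_one, zero_add]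
    have hm (Q : PseudoDiffOp e) : pairing Δ Q (single d m 1) = 0 := by
      rw [pairing_single, ← map_one (algebraMap F V), hΔ.map_algebraMap]
    rw [hsingle, mul_assoc, pairing_single_zero_mul hΔ, single_one_mul, pairing_derivPow hΔ,
      pairing_single_zero_mul hΔ (baseChange e B * P), hm, add_zero, ← single_one_mul,
      map_mul (baseChange e), map_mul (baseChange e), baseChange_single m, map_one]
    simp only [mul_assoc]

end PseudoDiffOp

end DifferentialAlgebra

/-! ### Matrices of pseudodifferential operators -/

section Matrix

variable {m n o p : Type*}

theorem map_diffPart_const_mul [Fintype n] (J : Matrix m n F) (X : Matrix n o (PseudoDiffOp d)) :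
    (J.map (const d) * X).map diffPart = J.map (const d) * X.map diffPart := by
  ext1 i j
  simp only [Matrix.map_apply, Matrix.mul_apply, map_sum, const_eq_single,
    diffPart_single_zero_mul]

theorem map_diffPart_mul_const [Fintype n] (X : Matrix m n (PseudoDiffOp d)) (I : Matrix n o F) :
    (X * I.map (const d)).map diffPart = X.map diffPart * I.map (const d) := by
  ext1 i j
  simp only [Matrix.map_apply, Matrix.mul_apply, map_sum, const_eq_single,
    diffPart_mul_single_zero]

theorem one_eq_map_const [DecidableEq n] :
    (1 : Matrix n n (PseudoDiffOp d)) = (1 : Matrix n n F).map (const d) :=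
  (Matrix.map_one _ const_zero rfl).symm

section Adler

variable [Fintype m] [Fintype n]

/-- The Adler map `P ↦ A (PA)_+ - (AP)_+ A`. -/
def adlerMap (A : Matrix m n (PseudoDiffOp d)) (P : Matrix n m (PseudoDiffOp d)) :
    Matrix m n (PseudoDiffOp d) :=
  A * (P * A).map diffPart - (A * P).map diffPart * A

theorem adlerMap_apply (A : Matrix m n (PseudoDiffOp d)) (P : Matrix n m (PseudoDiffOp d))
    (k : m) (l : n) : adlerMap A P k l =
      ∑ i, ∑ j, (A k j * diffPart (P j i * A i l) - diffPart (A k j * P j i) * A i l) := by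
  simp only [adlerMap, Matrix.sub_apply, Matrix.mul_apply, Matrix.map_apply, map_sum,
    Finset.mul_sum, Finset.sum_mul, Finset.sum_sub_distrib]
  rw [Finset.sum_comm]

theorem adlerMap_single [DecidableEq m] [DecidableEq n] (A : Matrix m n (PseudoDiffOp d)) (i : m)
    (j : n) (P : PseudoDiffOp d) (k : m) (l : n) : adlerMap A (Matrix.single j i P) k l =
      A k j * diffPart (P * A i l) - diffPart (A k j * P) * A i l := by
  rw [adlerMap_apply, Finset.sum_eq_single i, Finset.sum_eq_single j, Matrix.single_apply_same]
  · intro j' _ hj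
    rw [Matrix.single_apply_of_row_ne hj.symm, zero_mul, mul_zero, map_zero, mul_zero, zero_mul,
      sub_zero]
  · simp
  · intro i' _ hi
    refine Finset.sum_eq_zero fun j' _ => ?_
    rw [Matrix.single_apply_of_col_ne _ _ hi.symm, zero_mul, mul_zero, map_zero, mul_zero, zero_mul,
      sub_zero]
  · simp

theorem adlerMap_const_mul_mul_const [Fintype o] [Fintype p] (J : Matrix o m F)
    (A : Matrix m n (PseudoDiffOp d)) (I : Matrix n p F) (P : Matrix p o (PseudoDiffOp d)) :
    adlerMap (J.map (const d) * A * I.map (const d)) P = J.map (const d) *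
      adlerMap A (I.map (const d) * P * J.map (const d)) * I.map (const d) := by
  simp only [adlerMap, Matrix.mul_sub, Matrix.sub_mul, Matrix.mul_assoc, map_diffPart_const_mul]
  simp only [← Matrix.mul_assoc, map_diffPart_mul_const]

theorem IsInverse.adlerMap_eq [DecidableEq n] {A B : Matrix n n (PseudoDiffOp d)}
    (hAB : IsInverse A B) (P : Matrix n n (PseudoDiffOp d)) :
    adlerMap B P = -(B * adlerMap A (B * P * B) * B) := by
  have hPA : B * P * B * A = B * P := by rw [mul_assoc, hAB.2, mul_one]
  have hAP : A * (B * P * B) = P * B := by rw [mul_assoc B, ← mul_assoc, hAB.1, one_mul]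
  rw [adlerMap, adlerMap, hPA, hAP, mul_sub, sub_mul, neg_sub, ← mul_assoc B A, hAB.2, one_mul,
    ← mul_assoc B, mul_assoc _ A, hAB.1, mul_one]

end Adler

section BaseChange

variable [Algebra V W]

theorem map_derivMap_const (δ : Derivation F V W) (J : Matrix m n F) :
    (J.map (const d)).map (derivMap e δ) = 0 := by
  ext1 i j
  exact derivMap_const δ (J i j)

variable [IsDifferentialAlgebra d e]

theorem map_baseChange_const [IsScalarTower F V W] (J : Matrix m n F) :
    (J.map (const d)).map (baseChange e) = J.map (const e) := by
  ext1 i j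
  exact baseChange_const (J i j)

theorem IsInverse.map_baseChange [Fintype n] [DecidableEq n] {A B : Matrix n n (PseudoDiffOp d)}
    (hAB : IsInverse A B) : IsInverse (A.map (baseChange e)) (B.map (baseChange e)) := by
  have map_one : (1 : Matrix n n (PseudoDiffOp d)).map (baseChange e) = 1 :=
    Matrix.map_one _ (map_zero _) (_root_.map_one _)
  exact ⟨by rw [← Matrix.map_mul, hAB.1, map_one], by rw [← Matrix.map_mul, hAB.2, map_one]⟩

theorem map_derivMap_mul [Fintype n] {δ : Derivation F V W} (hδ : δ ∈ evolutionary d e)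
    (A : Matrix m n (PseudoDiffOp d)) (B : Matrix n o (PseudoDiffOp d)) :
    (A * B).map (derivMap e δ) = A.map (derivMap e δ) * B.map (baseChange e) +
      A.map (baseChange e) * B.map (derivMap e δ) := by
  ext1 i j
  simp only [Matrix.map_apply, Matrix.mul_apply, Matrix.add_apply, map_sum, derivMap_mul hδ,
    Finset.sum_add_distrib]

theorem IsInverse.map_derivMap [Fintype n] [DecidableEq n] {A B : Matrix n n (PseudoDiffOp d)}
    (hAB : IsInverse A B) {δ : Derivation F V W} (hδ : δ ∈ evolutionary d e) :
    B.map (derivMap e δ) =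
      -(B.map (baseChange e) * A.map (derivMap e δ) * B.map (baseChange e)) := by
  have hone : B.map (derivMap e δ) * A.map (baseChange e) +
      B.map (baseChange e) * A.map (derivMap e δ) = 0 := by
    rw [← map_derivMap_mul hδ, hAB.2, one_eq_map_const, map_derivMap_const]
  rw [← neg_mul, ← eq_neg_of_add_eq_zero_left hone, mul_assoc, hAB.map_baseChange.1, mul_one]

end BaseChange

section Pairing

variable [Fintype m] [Fintype n] {G : Type*} [AddCommGroup G]

/-- The pairing `∑_{i,j} ∫ Res (P_ji ∘ δA_ij) = ∫ Res tr (P ∘ δA)` of matrices of operators. -/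
def matrixPairing (Δ : V →+ W →+ G) (P : Matrix n m (PseudoDiffOp e))
    (A : Matrix m n (PseudoDiffOp d)) : G :=
  ∑ i, ∑ j, pairing Δ (P j i) (A i j)

theorem matrixPairing_single [DecidableEq m] [DecidableEq n] (Δ : V →+ W →+ G) (i : m) (j : n)
    (P : PseudoDiffOp e) (A : Matrix m n (PseudoDiffOp d)) :
    matrixPairing Δ (Matrix.single j i P) A = pairing Δ P (A i j) := by
  rw [matrixPairing, Finset.sum_eq_single i, Finset.sum_eq_single j, Matrix.single_apply_same]
  · intro l _ hl
    rw [Matrix.single_apply_of_row_ne hl.symm, map_zero, AddMonoidHom.zero_apply]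
  · simp
  · intro k _ hk
    refine Finset.sum_eq_zero fun l _ => ?_
    rw [Matrix.single_apply_of_col_ne _ _ hk.symm, map_zero, AddMonoidHom.zero_apply]
  · simp

variable [Algebra V W] {Δ : V →+ W →+ G}

theorem matrixPairing_const (hΔ : IsVariational d e Δ) (P : Matrix n m (PseudoDiffOp e))
    (J : Matrix m n F) : matrixPairing Δ P (J.map (const d)) = 0 :=
  Finset.sum_eq_zero fun i _ => Finset.sum_eq_zero fun j _ => pairing_const hΔ (P j i) (J i j)

variable [IsDifferentialAlgebra d e]

theorem matrixPairing_mul [Fintype o] (hΔ : IsVariational d e Δ) (P : Matrix o m (PseudoDiffOp e))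
    (A : Matrix m n (PseudoDiffOp d)) (B : Matrix n o (PseudoDiffOp d)) :
    matrixPairing Δ P (A * B) = matrixPairing Δ (B.map (baseChange e) * P) A +
      matrixPairing Δ (P * A.map (baseChange e)) B := by
  simp only [matrixPairing, Matrix.mul_apply, map_sum, AddMonoidHom.finsetSum_apply,
    Matrix.map_apply, pairing_mul hΔ, Finset.sum_add_distrib]
  congr 1
  · exact Finset.sum_congr rfl fun i _ => Finset.sum_comm
  · rw [Finset.sum_comm]
    exact (Finset.sum_congr rfl fun i _ => Finset.sum_comm).trans Finset.sum_comm

theorem matrixPairing_const_mul_mul_const [IsScalarTower F V W] [Fintype o] [Fintype p]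
    (hΔ : IsVariational d e Δ) (P : Matrix p o (PseudoDiffOp e)) (J : Matrix o m F)
    (A : Matrix m n (PseudoDiffOp d)) (I : Matrix n p F) :
    matrixPairing Δ P (J.map (const d) * A * I.map (const d)) =
      matrixPairing Δ (I.map (const e) * P * J.map (const e)) A := by
  rw [matrixPairing_mul hΔ, matrixPairing_const hΔ, add_zero, matrixPairing_mul hΔ,
    matrixPairing_const hΔ, zero_add, map_baseChange_const, map_baseChange_const]

theorem IsInverse.matrixPairing_eq [DecidableEq n] {A B : Matrix n n (PseudoDiffOp d)}
    (hAB : IsInverse A B) (hΔ : IsVariational d e Δ) (P : Matrix n n (PseudoDiffOp e)) :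
    matrixPairing Δ P B =
      -matrixPairing Δ (B.map (baseChange e) * P * B.map (baseChange e)) A := by
  have hone := matrixPairing_mul hΔ (P * B.map (baseChange e)) A B
  rw [hAB.1, one_eq_map_const, matrixPairing_const hΔ, mul_assoc P, hAB.map_baseChange.2, mul_one,
    ← mul_assoc] at hone
  exact eq_neg_of_add_eq_zero_right hone.symm

end Pairing

end Matrix

end

/-! ### Evaluation of the Adler identity -/

section

variable {F V W : Type*} [Field F] [CommRing V] [CommRing W] [Algebra F W] [Algebra V W]
  (e : Derivation F W W)

/-- The action `P(∂) f = ∑_n p_n ∂^n f` of `P(λ) = ∑_n p_n λ^n` on `f`. -/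
def applyOp (f : W) : V[X] →ₗ[V] W :=
  lsum fun n => LinearMap.toSpanSingleton V W (((e : W →ₗ[F] W) ^ n) f)

theorem applyOp_monomial (f : W) (n : ℕ) (a : V) :
    applyOp e f (monomial n a) = a • ((e : W →ₗ[F] W) ^ n) f := by
  simp [applyOp, lsum_apply]

theorem applyOp_C (f : W) (a : V) : applyOp e f (C a) = a • f :=
  applyOp_monomial e f 0 a

theorem applyOp_C_mul (f : W) (a : V) (P : V[X]) : applyOp e f (C a * P) = a • applyOp e f P := by
  rw [← smul_eq_C_mul, map_smul]

theorem applyOp_add_left (f g : W) (P : V[X]) :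
    applyOp e (f + g) P = applyOp e f P + applyOp e g P := by
  simp only [applyOp, lsum_apply, LinearMap.toSpanSingleton_apply, map_add, smul_add,
    Polynomial.sum_add]

theorem applyOp_X_mul (f : W) (P : V[X]) : applyOp e f (X * P) = applyOp e (e f) P := by
  induction P using Polynomial.induction_on' with
  | add P Q hP hQ => rw [mul_add, map_add, map_add, hP, hQ]
  | monomial n a =>
    rw [X_mul_monomial, applyOp_monomial, applyOp_monomial, pow_succ, Module.End.mul_apply]
    rfl

theorem applyOp_finsum {ι : Type*} (f : W) {P : ι → V[X]} (hP : (Function.support P).Finite) :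
    applyOp e f (∑ᶠ i, P i) = ∑ᶠ i, applyOp e f (P i) :=
  (applyOp e f).toAddMonoidHom.map_finsum hP

theorem applyOp_finsum_prod {ι κ : Type*} (f : W) {P : ι × κ → V[X]}
    (hP : (Function.support P).Finite) :
    applyOp e f (∑ᶠ x, P x) = ∑ᶠ (i) (j), applyOp e f (P (i, j)) :=
  (applyOp_finsum e f hP).trans
    (finsum_curry _ (hP.subset (Function.support_comp_subset (map_zero (applyOp e f)) P)))

end

section

variable {F V : Type*} [Field F] [CommRing V] [Algebra F V] {d : Derivation F V V}

theorem lamAdd_monomial (n : ℕ) (a : V) :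
    lamAdd d (monomial n a) = monomial (n + 1) a + monomial n (d a) := by
  simp [lamAdd, lsum_apply, X_mul_monomial]

variable {W : Type*} [CommRing W] [Algebra F W] [Algebra V W] {e : Derivation F W W}
  [IsDifferentialAlgebra d e]

theorem applyOp_lamAdd (f : W) (P : V[X]) :
    applyOp e f (lamAdd d P) = e (applyOp e f P) := by
  induction P using Polynomial.induction_on' with
  | add P Q hP hQ => simp only [map_add, hP, hQ]
  | monomial n a =>
    rw [lamAdd_monomial, map_add, applyOp_monomial, applyOp_monomial, applyOp_monomial,
      deriv_smul d, pow_succ', Module.End.mul_apply]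
    rfl

theorem applyOp_lamAdd_pow (f : W) (P : V[X]) (k : ℕ) :
    applyOp e f ((lamAdd d ^ k) P) = ((e : W →ₗ[F] W) ^ k) (applyOp e f P) := by
  simp only [Module.End.pow_apply]
  exact Function.Semiconj.iterate_right (applyOp_lamAdd (d := d) f) k P

theorem applyOp_substApply (f : W) (P : V[X]) (b : V) :
    applyOp e f (substApply d P b) = applyOp e (b • f) P := by
  simp only [substApply, Polynomial.sum, map_sum, applyOp_C_mul, applyOp_lamAdd_pow, applyOp_C]
  simp [applyOp, lsum_apply, Polynomial.sum]

theorem applyOp_evalLamSub_adjoint (f : W) (A : PseudoDiffOp d) (r : ℤ) :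
    applyOp e f (A.adjoint.evalLamSub r) =
      residue (derivPow (-r - 1) (single e 0 f * baseChange e A)) := by
  rw [evalLamSub, applyOp_finsum e f (finite_support_evalLamSub _ r), ← derivPow_mul, residue_mul,
    finsum_int_eq_finsum_nat_sub (-r - 1)]
  · refine finsum_congr fun l => ?_
    have hsign : ((r.negOnePow : ℤ) : W) * (r.negOnePow : ℤ) = 1 := by
      rw [← Int.cast_mul, ← Units.val_mul, Int.units_mul_self, Units.val_one, Int.cast_one]
    rw [coeff_derivPow_single _ 0 f (k := l) (by ring), coeff_adjoint, map_zsmul, applyOp_monomial,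
      show -r - 1 = -(r + 1) by ring, Ring.choose_neg, show r + 1 + (l : ℤ) - 1 = r + l by ring,
      show -(r + 1) - (l : ℤ) = -(r + l) - 1 by ring, Int.negOnePow_add,
      Algebra.smul_def (R := V), map_zsmul, ← baseChange_derivPow, residue_baseChange]
    simp only [zsmul_eq_mul, Units.smul_def, Units.val_mul, smul_eq_mul]
    push_cast
    linear_combination ((l : ℤ).negOnePow : ℤ) * ((Ring.choose (r + l) l : ℤ) : W) *
      algebraMap V W (residue (derivPow (-(r + l) - 1) A)) * ((e : W →ₗ[F] W) ^ l) f * hsign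
  · intro n hn
    rw [(orderLE_single 0 f).derivPow _ n (by lia), zero_mul]

theorem applyOp_adlerFst (f : W) (B A : PseudoDiffOp d) (r s : ℤ) :
    applyOp e f (adlerFst B A r s) =
      (baseChange e B * diffPart (derivPow (-r - 1) (single e 0 f) * baseChange e A)).coeff s := by
  rw [coeff_mul_diffPart, adlerFst, applyOp_finsum_prod e f (finite_support_adlerFst B A r s)]
  refine finsum_congr fun p => ?_
  rw [coeff_mul_derivPow_single_zero]
  refine finsum_congr fun q => ?_
  rw [map_zsmul, applyOp_C_mul, applyOp_lamAdd_pow, applyOp_evalLamSub_adjoint, derivPow_mul,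
    derivPow_derivPow, show -(p : ℤ) - 1 + (-r - 1) = -(r + p + 1) - 1 by ring,
    Algebra.smul_def (R := V), coeff_baseChange]

theorem applyOp_adlerSnd (f : W) (B A : PseudoDiffOp d) (r s : ℤ) :
    applyOp e f (adlerSnd B A r s) =
      (diffPart (baseChange e B * derivPow (-r - 1) (single e 0 f)) * baseChange e A).coeff s := by
  rw [← single_one_mul, ← mul_assoc, diffPart_mul_single_zero, mul_assoc, coeff_diffPart_mul,
    adlerSnd, applyOp_finsum_prod e f (finite_support_adlerSnd B A r s)]
  refine finsum_congr fun p => ?_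
  rw [coeff_derivPow, mul_finsum' _ _ (finite_support_derivPow _ _ _)]
  refine finsum_congr fun q => ?_
  rw [map_nsmul, applyOp_C_mul, applyOp_lamAdd_pow, applyOp_C, coeff_single_zero_mul,
    coeff_mul_single_one, coeff_baseChange, coeff_baseChange, Ring.choose_natCast,
    Algebra.smul_def (R := V), Algebra.smul_def (R := V), natCast_zsmul, mul_smul_comm, mul_comm f,
    show (p : ℤ) - (-r - 1) = r + p + 1 by ring, show s - (p : ℤ) + q = s + q - p by ring]

end

/-! ### The Adler–Gelfand–Dickey identity -/

namespace LambdaBracket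

variable {F V W : Type*} [Field F] [CommRing V] [Algebra F V] [CommRing W] [Algebra F W]
  [Algebra V W] [IsScalarTower F V W] {d : Derivation F V V} {e : Derivation F W W}
  (L : LambdaBracket d)

/-- The Hamiltonian derivations `c ↦ {a_∂ c} f`, for `a ∈ V` and `f ∈ W`. -/
def hamiltonian (e : Derivation F W W) : V →+ W →+ Derivation F V W :=
  AddMonoidHom.mk' (fun a => AddMonoidHom.mk' (fun f =>
    Derivation.mk' ((applyOp e f).restrictScalars F ∘ₗ L.br a) fun b c => by
      simp only [LinearMap.comp_apply, LinearMap.restrictScalars_apply, L.leibniz_right]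
      rw [mul_comm _ (C c), mul_comm _ (C b), map_add, applyOp_C_mul, applyOp_C_mul, add_comm])
    fun f g => Derivation.ext fun c => applyOp_add_left e f g (L.br a c))
    fun a b => AddMonoidHom.ext fun f => Derivation.ext fun c => by
      change applyOp e f (L.br (a + b) c) = applyOp e f (L.br a c) + applyOp e f (L.br b c)
      rw [map_add, LinearMap.add_apply, map_add]

theorem hamiltonian_apply (a c : V) (f : W) :
    L.hamiltonian e a f c = applyOp e f (L.br a c) := rfl

variable [IsDifferentialAlgebra d e]

theorem hamiltonian_mem_evolutionary (a : V) (f : W) : L.hamiltonian e a f ∈ evolutionary d e :=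
  fun c => by rw [hamiltonian_apply, hamiltonian_apply, L.deriv_right, applyOp_lamAdd]

theorem isVariational_hamiltonian : IsVariational d e (L.hamiltonian e) := by
  have map_mul (a b : V) (f : W) : L.hamiltonian e (a * b) f =
      L.hamiltonian e a (b • f) + L.hamiltonian e b (a • f) := by
    ext c
    rw [Derivation.add_apply, hamiltonian_apply, hamiltonian_apply, hamiltonian_apply,
      L.leibniz_left, map_add, applyOp_substApply, applyOp_substApply]
  refine ⟨map_mul, fun a f => ?_, fun c f => ?_⟩
  · ext b
    rw [Derivation.neg_apply, hamiltonian_apply, hamiltonian_apply, L.deriv_left, map_neg,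
      applyOp_X_mul]
  · have map_one : L.hamiltonian e 1 f = 0 := by simpa using map_mul 1 1 f
    ext b
    rw [hamiltonian_apply, Algebra.algebraMap_eq_smul_one, map_smul, LinearMap.smul_apply,
      LinearMap.map_smul_of_tower, ← hamiltonian_apply, map_one, Derivation.zero_apply, smul_zero]

theorem matrixPairing_mem_evolutionary {m n : Type*} [Fintype m] [Fintype n]
    (P : Matrix n m (PseudoDiffOp e)) (A : Matrix m n (PseudoDiffOp d)) :
    matrixPairing (L.hamiltonian e) P A ∈ evolutionary d e :=
  sum_mem fun _ _ => sum_mem fun _ _ => finsum_induction (p := (· ∈ evolutionary d e))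
    (zero_mem _) (fun _ _ => add_mem) fun _ => L.hamiltonian_mem_evolutionary _ _

theorem derivMap_pairing_of_isAdlerType {m n : Type*} {A : Matrix m n (PseudoDiffOp d)}
    (hA : IsAdlerType L A) (P : PseudoDiffOp e) (i : m) (j : n) (k : m) (l : n) :
    derivMap e (pairing (L.hamiltonian e) P (A i j)) (A k l) =
      baseChange e (A k j) * diffPart (P * baseChange e (A i l)) -
        diffPart (baseChange e (A k j) * P) * baseChange e (A i l) := by
  obtain ⟨K, hK⟩ := (A i j).exists_orderLE
  obtain ⟨K', hK'⟩ := (A i l).exists_orderLE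
  obtain ⟨K'', hK''⟩ := (A k j).exists_orderLE
  induction P using derivPow_single_induction (min (-K) (min (-K') (-K'')) - 2) with
  | low P hP =>
    rw [pairing_eq_zero _ hP hK (by lia), (hP.mul hK'.baseChange).diffPart_eq_zero (by lia),
      (hK''.baseChange.mul hP).diffPart_eq_zero (by lia), map_zero, AddMonoidHom.zero_apply,
      mul_zero, zero_mul, sub_zero]
  | add P Q hP hQ =>
    rw [map_add, AddMonoidHom.add_apply, map_add, AddMonoidHom.add_apply, hP, hQ, add_mul, map_add,
      mul_add, mul_add, map_add, add_mul]
    abel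
  | derivPow_single q f =>
    ext s
    obtain ⟨r, rfl⟩ : ∃ r : ℤ, q = -r - 1 := ⟨-q - 1, by ring⟩
    rw [pairing_derivPow_single_zero, coeff_derivMap, hamiltonian_apply, hA i j k l r s, map_sub,
      applyOp_adlerFst, applyOp_adlerSnd, PseudoDiffOp.coeff_sub]

end LambdaBracket

/-- The Adler–Gelfand–Dickey identity `δ_P A = c (A (PA)_+ - (AP)_+ A)` for the Hamiltonian
derivations `δ_P` dual to `A`, with test operators `P` over the differential algebra `(W, e)`. -/
def IsAGD {F V W : Type*} [Field F] [CommRing V] [Algebra F V] [CommRing W] [Algebra F W]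
    [Algebra V W] [IsScalarTower F V W] {d : Derivation F V V} (L : LambdaBracket d)
    (e : Derivation F W W) [IsDifferentialAlgebra d e] {m n : Type*} [Fintype m] [Fintype n]
    (c : ℤ) (A : Matrix m n (PseudoDiffOp d)) : Prop :=
  ∀ P : Matrix n m (PseudoDiffOp e), A.map (derivMap e (matrixPairing (L.hamiltonian e) P A)) =
    c • adlerMap (A.map (baseChange e)) P

section

variable {F V W : Type*} [Field F] [CommRing V] [Algebra F V] [CommRing W] [Algebra F W]
  [Algebra V W] [IsScalarTower F V W] {d : Derivation F V V} {e : Derivation F W W}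
  [IsDifferentialAlgebra d e] {L : LambdaBracket d} {m n o p : Type*} [Fintype m] [Fintype n]

theorem IsAdlerType.isAGD {A : Matrix m n (PseudoDiffOp d)} (hA : IsAdlerType L A) :
    IsAGD L e 1 A := fun P => by
  ext1 k l
  rw [one_smul, adlerMap_apply]
  simp only [Matrix.map_apply, matrixPairing, map_sum, AddMonoidHom.finsetSum_apply,
    L.derivMap_pairing_of_isAdlerType hA]

theorem IsAGD.isAdlerType {A : Matrix m n (PseudoDiffOp d)} (hA : IsAGD L e 1 A) {f : W}
    (hf : Function.Injective (applyOp (V := V) e f)) : IsAdlerType L A := fun i j k l r s => by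
  classical
  have hentry := congrArg (coeff · s) (congrFun₂
    (hA (Matrix.single j i (derivPow (-r - 1) (single e 0 f)))) k l)
  rw [matrixPairing_single, pairing_derivPow_single_zero, one_smul, adlerMap_single] at hentry
  apply hf
  rw [map_sub, applyOp_adlerFst, applyOp_adlerSnd, ← PseudoDiffOp.coeff_sub]
  exact hentry

theorem IsAGD.inverse [DecidableEq n] {c : ℤ} {A B : Matrix n n (PseudoDiffOp d)}
    (hA : IsAGD L e c A) (hAB : IsInverse A B) : IsAGD L e (-c) B := fun P => by
  rw [hAB.map_derivMap (L.matrixPairing_mem_evolutionary P B),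
    hAB.matrixPairing_eq L.isVariational_hamiltonian, hAB.map_baseChange.adlerMap_eq]
  have hneg (δ : Derivation F V W) : A.map (derivMap e (-δ)) = -A.map (derivMap e δ) := by
    rw [map_neg]; rfl
  rw [hneg, hA, Matrix.mul_neg, Matrix.neg_mul, neg_neg, neg_smul, smul_neg, neg_neg,
    Matrix.mul_smul, Matrix.smul_mul]

theorem IsAGD.const_mul_mul_const [Fintype o] [Fintype p] {c : ℤ}
    {A : Matrix m n (PseudoDiffOp d)} (hA : IsAGD L e c A) (J : Matrix o m F) (I : Matrix n p F) :
    IsAGD L e c (J.map (const d) * A * I.map (const d)) := fun P => by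
  have hδ := L.matrixPairing_mem_evolutionary (I.map (const e) * P * J.map (const e)) A
  rw [matrixPairing_const_mul_mul_const L.isVariational_hamiltonian, map_derivMap_mul hδ,
    map_derivMap_mul hδ, map_derivMap_const, map_derivMap_const, Matrix.mul_zero, add_zero,
    Matrix.zero_mul, zero_add, hA, Matrix.map_mul, Matrix.map_mul, map_baseChange_const,
    map_baseChange_const, adlerMap_const_mul_mul_const, Matrix.mul_smul, Matrix.smul_mul]

end

/-! ### The square-zero extension -/

section

variable {F V : Type*} [Field F] [CommRing V] [Algebra F V] (d : Derivation F V V)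

theorem lamAdd_smul (a : V) (P : V[X]) : lamAdd d (a • P) = a • lamAdd d P + d a • P := by
  induction P using Polynomial.induction_on' with
  | add P Q hP hQ => rw [smul_add, map_add, hP, hQ, map_add, smul_add, smul_add]; abel
  | monomial n b =>
    simp only [smul_monomial, lamAdd_monomial, smul_add, smul_eq_mul, Derivation.leibniz, map_add,
      mul_comm b, add_assoc]

/-- The extension of `d` to the square-zero extension `V ⊕ V[λ] ε` of `V`, with `ε² = 0` and
`∂ε = λε`, so that `P(∂) ε = P ε`. -/
def sqZeroDeriv : Derivation F (TrivSqZeroExt V V[X]) (TrivSqZeroExt V V[X]) :=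
  Derivation.mk'
    { toFun := fun x => (d x.fst, lamAdd d x.snd)
      map_add' := fun x y => TrivSqZeroExt.ext (map_add d _ _) (map_add (lamAdd d) _ _)
      map_smul' := fun c x => TrivSqZeroExt.ext (d.map_smul _ _) (map_smul (lamAdd d) _ _) }
    fun x y => TrivSqZeroExt.ext (d.leibniz _ _) <| by
      change lamAdd d (x * y).snd = x.fst • lamAdd d y.snd + MulOpposite.op (d y.fst) • x.snd +
        (y.fst • lamAdd d x.snd + MulOpposite.op (d x.fst) • y.snd)
      rw [TrivSqZeroExt.snd_mul, op_smul_eq_smul, op_smul_eq_smul, op_smul_eq_smul, map_add,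
        lamAdd_smul, lamAdd_smul]
      abel

theorem sqZeroDeriv_inl (a : V) :
    sqZeroDeriv d (TrivSqZeroExt.inl a) = TrivSqZeroExt.inl (d a) :=
  TrivSqZeroExt.ext rfl (map_zero (lamAdd d))

theorem sqZeroDeriv_inr (P : V[X]) :
    sqZeroDeriv d (TrivSqZeroExt.inr P) = TrivSqZeroExt.inr (lamAdd d P) :=
  TrivSqZeroExt.ext (map_zero d) rfl

instance isDifferentialAlgebra_sqZeroDeriv : IsDifferentialAlgebra d (sqZeroDeriv d) :=
  ⟨sqZeroDeriv_inl d⟩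

theorem applyOp_sqZeroDeriv (P : V[X]) :
    applyOp (sqZeroDeriv d) (TrivSqZeroExt.inr 1) P = TrivSqZeroExt.inr P := by
  have pow_inr (n : ℕ) : ((sqZeroDeriv d : TrivSqZeroExt V V[X] →ₗ[F] TrivSqZeroExt V V[X]) ^ n)
      (TrivSqZeroExt.inr 1) = TrivSqZeroExt.inr (X ^ n) := by
    induction n with
    | zero => rfl
    | succ n ih =>
      rw [pow_succ', Module.End.mul_apply, ih]
      refine (sqZeroDeriv_inr d _).trans ?_
      rw [← monomial_one_right_eq_X_pow, lamAdd_monomial, d.map_one_eq_zero, map_zero, add_zero,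
        monomial_one_right_eq_X_pow]
  induction P using Polynomial.induction_on' with
  | add P Q hP hQ => rw [map_add, hP, hQ, TrivSqZeroExt.inr_add]
  | monomial n a =>
    rw [applyOp_monomial, pow_inr, ← TrivSqZeroExt.inr_smul, ← monomial_one_right_eq_X_pow,
      smul_monomial, smul_eq_mul, mul_one]

theorem applyOp_sqZeroDeriv_injective :
    Function.Injective (applyOp (V := V) (sqZeroDeriv d) (TrivSqZeroExt.inr 1)) := by
  rw [funext (applyOp_sqZeroDeriv d)]
  exact TrivSqZeroExt.inr_injective

end

end AdlerType

end

theorem proposition4p5_general {F V m n : Type*} [Field F] [CommRing V] [Algebra F V]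
    [Fintype m] [DecidableEq m] [Fintype n] [DecidableEq n] {d : Derivation F V V}
    (L : AdlerType.LambdaBracket d) {A : Matrix n n (AdlerType.PseudoDiffOp d)}
    (hA : AdlerType.IsAdlerType L A) (I : Matrix n m F) (J : Matrix m n F)
    {Q : Matrix m m (AdlerType.PseudoDiffOp d)}
    (hQ : AdlerType.IsQuasideterminant A (I.map (AdlerType.PseudoDiffOp.const d))
      (J.map (AdlerType.PseudoDiffOp.const d)) Q) :
    AdlerType.IsAdlerType L Q := by
  obtain ⟨B, hAB, hBQ⟩ := hQ
  have hA' : AdlerType.IsAGD L (AdlerType.sqZeroDeriv d) 1 A := hA.isAGD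
  have hQ' := ((hA'.inverse hAB).const_mul_mul_const J I).inverse hBQ
  rw [neg_neg] at hQ'
  exact hQ'.isAdlerType (AdlerType.applyOp_sqZeroDeriv_injective d)

/-- Over a differential algebra with a `λ`-bracket, every existing generalized quasideterminant
`|A|_{IJ}` of an Adler type operator `A`, with `I`, `J` constant matrices, is of Adler type for
the same `λ`-bracket. -/
theorem proposition4p5 {F V : Type*} [Field F] [CharZero F] [CommRing V] [Algebra F V]
    (d : Derivation F V V) (L : AdlerType.LambdaBracket d) (N M : ℕ) (hMN : M ≤ N)
    (A : Matrix (Fin N) (Fin N) (AdlerType.PseudoDiffOp d)) (hA : AdlerType.IsAdlerType L A)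
    (I : Matrix (Fin N) (Fin M) F) (J : Matrix (Fin M) (Fin N) F)
    (Q : Matrix (Fin M) (Fin M) (AdlerType.PseudoDiffOp d))
    (hQ : AdlerType.IsQuasideterminant A (I.map (AdlerType.PseudoDiffOp.const d))
      (J.map (AdlerType.PseudoDiffOp.const d)) Q) :
    AdlerType.IsAdlerType L Q :=
  proposition4p5_general L hA I J hQ
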